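/- Let $\mathbb F=\mathbb R$ or $\mathbb F=\mathbb C$ and let $\alpha,\beta,\gamma,\delta\in\mathbb F$. Consider the sixth Painlevé equation $$y''=\frac12\Big(\frac1y+\frac1{y-1}+\frac1{y-x}\Big)(y')^2-\Big(\frac1x+\frac1{x-1}+\frac1{y-x}\Big)y'+\frac{y(y-1)(y-x)}{x^2(x-1)^2}\Big[\alpha+\beta\frac{x}{y^2}+\gamma\frac{x-1}{(y-1)^2}+\delta\frac{x(x-1)}{(y-x)^2}\Big]$$ on its regular set $\Omega=\{(x,y)\in\mathbb F^2: x\ne0,1,\ y\ne 0,1,x\}$. For an open set $U\subseteq\Omega$, let $L(U)$ be its Lie point symmetry algebra over $\mathbb F$ on $U$: the space of smooth vector fields $\hat X=\xi(x,y)\partial_x+\phi(x,y)\partial_y$ on $U$ (holomorphic ones if $\mathbb F=\mathbb C$) whose second prolongation annihilates the equation at all points $(x,y,y',y'')$ that satisfy it and have $(x,y)\in U$. (i) If $L(U)\neq\{0\}$ for some open $U\subseteq\Omega$, then $\alpha=\beta=\gamma=0$ and $\delta=\frac12$. (ii) Conversely, let $\alpha=\beta=\gamma=0$ and $\delta=\frac12$.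 Then every point of $\Omega$ has an open neighbourhood $N\subseteq\Omega$ such that $\dim_{\mathbb F}L(V)=8$ for every nonempty connected open set $V\subseteq N$. Moreover, the equation is linearizable near every point of $\Omega$: some smooth point transformation $(x,y)\mapsto(t,u)$ with smooth inverse, defined on a neighbourhood of the point, carries it to $d^2u/dt^2=0$ (at all jets at which $du/dt$ is defined). -/

import Mathlib

open scoped ContDiff

namespace PointSymmetry

variable {𝕜 : Type*} [RCLike 𝕜]

/-- The total derivative `D f = f_x + p f_y` of a function `f(x, y)`;
points of the first jet space are written `(x, y, p)` with `p = y'`. -/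
noncomputable def totalDeriv (f : 𝕜 × 𝕜 → 𝕜) : 𝕜 × 𝕜 × 𝕜 → 𝕜 :=
  fun w => fderiv 𝕜 f (w.1, w.2.1) (1, w.2.2)

/-- The total derivative `D g = g_x + p g_y + q g_p` of a function `g(x, y, p)`;
points of the second jet space are written `(x, y, p, q)` with `p = y'`, `q = y''`. -/
noncomputable def totalDeriv₁ (g : 𝕜 × 𝕜 × 𝕜 → 𝕜) : 𝕜 × 𝕜 × 𝕜 × 𝕜 → 𝕜 :=
  fun j => fderiv 𝕜 g (j.1, j.2.1, j.2.2.1) (1, j.2.2.1, j.2.2.2)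

/-- For the vector field `X = ξ ∂_x + φ ∂_y`, encoded as `X (x, y) = (ξ (x, y), φ (x, y))`,
the coefficient `φ^x = D φ - p D ξ` of `∂_p` in the first prolongation of `X`. -/
noncomputable def prolongCoeff₁ (X : 𝕜 × 𝕜 → 𝕜 × 𝕜) : 𝕜 × 𝕜 × 𝕜 → 𝕜 :=
  fun w => totalDeriv (fun z => (X z).2) w - w.2.2 * totalDeriv (fun z => (X z).1) w

/-- The coefficient `φ^{xx} = D φ^x - q D ξ` of `∂_q` in the second prolongation of `X`. -/
noncomputable def prolongCoeff₂ (X : 𝕜 × 𝕜 → 𝕜 × 𝕜) : 𝕜 × 𝕜 × 𝕜 × 𝕜 → 𝕜 :=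
  fun j => totalDeriv₁ (prolongCoeff₁ X) j -
    j.2.2.2 * totalDeriv (fun z => (X z).1) (j.1, j.2.1, j.2.2.1)

/-- The second prolongation
`pr X = ξ ∂_x + φ ∂_y + φ^x ∂_p + φ^{xx} ∂_q` of the vector field `X`. -/
noncomputable def prolong (X : 𝕜 × 𝕜 → 𝕜 × 𝕜) : 𝕜 × 𝕜 × 𝕜 × 𝕜 → 𝕜 × 𝕜 × 𝕜 × 𝕜 :=
  fun j => ((X (j.1, j.2.1)).1, (X (j.1, j.2.1)).2,
    prolongCoeff₁ X (j.1, j.2.1, j.2.2.1), prolongCoeff₂ X j)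

/-- The determining equations on `U` for the ODE `F (x, y, y', y'') = 0`:
`(pr X) F = 0` at each point of the second jet space over `U` at which `F = 0`. -/
def SatisfiesDetermining (F : 𝕜 × 𝕜 × 𝕜 × 𝕜 → 𝕜) (U : Set (𝕜 × 𝕜))
    (X : 𝕜 × 𝕜 → 𝕜 × 𝕜) : Prop :=
  ∀ x y p q : 𝕜, (x, y) ∈ U → F (x, y, p, q) = 0 →
    fderiv 𝕜 F (x, y, p, q) (prolong X (x, y, p, q)) = 0

section Linear

variable {U : Set (𝕜 × 𝕜)} {X Y : 𝕜 × 𝕜 → 𝕜 × 𝕜}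

theorem differentiableAt_fst (hU : IsOpen U) (hX : ContDiffOn 𝕜 ∞ X U) {z : 𝕜 × 𝕜}
    (hz : z ∈ U) : DifferentiableAt 𝕜 (fun z => (X z).1) z :=
  ((hX.contDiffAt (hU.mem_nhds hz)).differentiableAt (by simp)).fst

theorem differentiableAt_snd (hU : IsOpen U) (hX : ContDiffOn 𝕜 ∞ X U) {z : 𝕜 × 𝕜}
    (hz : z ∈ U) : DifferentiableAt 𝕜 (fun z => (X z).2) z :=
  ((hX.contDiffAt (hU.mem_nhds hz)).differentiableAt (by simp)).snd

theorem differentiableAt_totalDeriv {f : 𝕜 × 𝕜 → 𝕜} {w : 𝕜 × 𝕜 × 𝕜}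
    (hf : ContDiffAt 𝕜 ∞ f (w.1, w.2.1)) : DifferentiableAt 𝕜 (totalDeriv f) w := by
  have h1 : DifferentiableAt 𝕜 (fderiv 𝕜 f) (w.1, w.2.1) :=
    (hf.fderiv_right (m := ∞) (by simp)).differentiableAt (by simp)
  have h2 : DifferentiableAt 𝕜 (fun w : 𝕜 × 𝕜 × 𝕜 => fderiv 𝕜 f (w.1, w.2.1)) w :=
    DifferentiableAt.comp (g := fderiv 𝕜 f) (f := fun w : 𝕜 × 𝕜 × 𝕜 => (w.1, w.2.1)) w h1
      (by fun_prop)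
  exact h2.clm_apply (by fun_prop)

theorem differentiableAt_prolongCoeff₁ (hU : IsOpen U) (hX : ContDiffOn 𝕜 ∞ X U)
    {w : 𝕜 × 𝕜 × 𝕜} (hw : (w.1, w.2.1) ∈ U) : DifferentiableAt 𝕜 (prolongCoeff₁ X) w := by
  have h := hX.contDiffAt (hU.mem_nhds hw)
  have h1 := differentiableAt_totalDeriv (w := w) h.fst
  have h2 := differentiableAt_totalDeriv (w := w) h.snd
  exact h2.sub ((by fun_prop : DifferentiableAt 𝕜 (fun w : 𝕜 × 𝕜 × 𝕜 => w.2.2) w).mul h1)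

theorem prolongCoeff₁_add (hU : IsOpen U) (hX : ContDiffOn 𝕜 ∞ X U) (hY : ContDiffOn 𝕜 ∞ Y U)
    {w : 𝕜 × 𝕜 × 𝕜} (hw : (w.1, w.2.1) ∈ U) :
    prolongCoeff₁ (X + Y) w = prolongCoeff₁ X w + prolongCoeff₁ Y w := by
  simp only [prolongCoeff₁, totalDeriv, Pi.add_apply, Prod.fst_add, Prod.snd_add]
  rw [fderiv_fun_add (differentiableAt_fst hU hX hw) (differentiableAt_fst hU hY hw),
    fderiv_fun_add (differentiableAt_snd hU hX hw) (differentiableAt_snd hU hY hw)]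
  simp only [add_apply]
  ring

theorem prolongCoeff₁_smul (hU : IsOpen U) (hX : ContDiffOn 𝕜 ∞ X U) (c : 𝕜)
    {w : 𝕜 × 𝕜 × 𝕜} (hw : (w.1, w.2.1) ∈ U) :
    prolongCoeff₁ (c • X) w = c * prolongCoeff₁ X w := by
  simp only [prolongCoeff₁, totalDeriv, Pi.smul_apply, Prod.smul_fst, Prod.smul_snd]
  rw [fderiv_fun_const_smul (differentiableAt_fst hU hX hw),
    fderiv_fun_const_smul (differentiableAt_snd hU hX hw)]
  simp only [smul_apply, smul_eq_mul]
  ring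

theorem eventually_mem (hU : IsOpen U) {w : 𝕜 × 𝕜 × 𝕜} (hw : (w.1, w.2.1) ∈ U) :
    ∀ᶠ v : 𝕜 × 𝕜 × 𝕜 in nhds w, (v.1, v.2.1) ∈ U :=
  (by fun_prop : Continuous fun v : 𝕜 × 𝕜 × 𝕜 => (v.1, v.2.1)).continuousAt.preimage_mem_nhds
    (hU.mem_nhds hw)

theorem prolong_add (hU : IsOpen U) (hX : ContDiffOn 𝕜 ∞ X U) (hY : ContDiffOn 𝕜 ∞ Y U)
    {j : 𝕜 × 𝕜 × 𝕜 × 𝕜} (hj : (j.1, j.2.1) ∈ U) :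
    prolong (X + Y) j = prolong X j + prolong Y j := by
  have hw : (((j.1, j.2.1, j.2.2.1) : 𝕜 × 𝕜 × 𝕜).1, (j.1, j.2.1, j.2.2.1).2.1) ∈ U := hj
  have he : prolongCoeff₁ (X + Y) =ᶠ[nhds (j.1, j.2.1, j.2.2.1)]
      (fun w => prolongCoeff₁ X w + prolongCoeff₁ Y w) :=
    (eventually_mem hU hw).mono fun v hv => prolongCoeff₁_add hU hX hY hv
  have h2 : prolongCoeff₂ (X + Y) j = prolongCoeff₂ X j + prolongCoeff₂ Y j := by
    simp only [prolongCoeff₂, totalDeriv₁, he.fderiv_eq]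
    rw [fderiv_fun_add (differentiableAt_prolongCoeff₁ hU hX hw)
      (differentiableAt_prolongCoeff₁ hU hY hw)]
    simp only [totalDeriv, Pi.add_apply, Prod.fst_add]
    rw [fderiv_fun_add (differentiableAt_fst hU hX hj) (differentiableAt_fst hU hY hj)]
    simp only [add_apply]
    ring
  simp only [prolong, h2, prolongCoeff₁_add hU hX hY hw, Pi.add_apply, Prod.fst_add,
    Prod.snd_add, Prod.mk_add_mk]

theorem prolong_smul (hU : IsOpen U) (hX : ContDiffOn 𝕜 ∞ X U) (c : 𝕜)
    {j : 𝕜 × 𝕜 × 𝕜 × 𝕜} (hj : (j.1, j.2.1) ∈ U) :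
    prolong (c • X) j = c • prolong X j := by
  have hw : (((j.1, j.2.1, j.2.2.1) : 𝕜 × 𝕜 × 𝕜).1, (j.1, j.2.1, j.2.2.1).2.1) ∈ U := hj
  have he : prolongCoeff₁ (c • X) =ᶠ[nhds (j.1, j.2.1, j.2.2.1)]
      (fun w => c • prolongCoeff₁ X w) :=
    (eventually_mem hU hw).mono fun v hv => prolongCoeff₁_smul hU hX c hv
  have h2 : prolongCoeff₂ (c • X) j = c * prolongCoeff₂ X j := by
    simp only [prolongCoeff₂, totalDeriv₁, he.fderiv_eq]
    rw [fderiv_fun_const_smul (differentiableAt_prolongCoeff₁ hU hX hw)]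
    simp only [totalDeriv, Pi.smul_apply, Prod.smul_fst]
    rw [fderiv_fun_const_smul (differentiableAt_fst hU hX hj)]
    simp only [smul_apply, smul_eq_mul]
    ring
  simp only [prolong, h2, prolongCoeff₁_smul hU hX c hw, Pi.smul_apply, Prod.smul_fst,
    Prod.smul_snd, Prod.smul_mk, smul_eq_mul]

end Linear

/-- The Lie point symmetry algebra over `𝕜`, on the open set `U` of the `(x, y)`-plane, of the ODE
`F (x, y, y', y'') = 0`: all smooth vector fields on `U` that satisfy the determining equations,
as a `𝕜`-linear space. A vector field on `U` is represented by its extension by zero to the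
whole plane, so that vector fields which agree on `U` are equal. -/
def symmetryAlgebra (F : 𝕜 × 𝕜 × 𝕜 × 𝕜 → 𝕜) (U : Set (𝕜 × 𝕜)) (hU : IsOpen U) :
    Submodule 𝕜 (𝕜 × 𝕜 → 𝕜 × 𝕜) where
  carrier := {X | ContDiffOn 𝕜 ∞ X U ∧ (∀ z, z ∉ U → X z = 0) ∧ SatisfiesDetermining F U X}
  add_mem' := by
    rintro X Y ⟨hX, hX0, hXs⟩ ⟨hY, hY0, hYs⟩
    refine ⟨hX.add hY, fun z hz => by simp [hX0 z hz, hY0 z hz], fun x y p q hz hF => ?_⟩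
    rw [prolong_add hU hX hY hz, map_add, hXs x y p q hz hF, hYs x y p q hz hF, add_zero]
  zero_mem' := by
    refine ⟨contDiffOn_const, fun _ _ => rfl, fun x y p q hz _ => ?_⟩
    have h := prolong_smul (X := 0) hU contDiffOn_const (0 : 𝕜) (j := (x, y, p, q)) hz
    rw [zero_smul, zero_smul] at h
    rw [h, map_zero]
  smul_mem' := by
    rintro c X ⟨hX, hX0, hXs⟩
    refine ⟨contDiffOn_const.smul hX, fun z hz => by simp [hX0 z hz], fun x y p q hz hF => ?_⟩
    rw [prolong_smul hU hX c hz, map_smul, hXs x y p q hz hF, smul_zero]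

/-- For a point transformation `t = T(x, y)`, `u = S(x, y)`, encoded as `Φ = (T, S)`, the first
derivative `du/dt = D S / D T` as a function of `(x, y, p)`. -/
noncomputable def transformedDeriv₁ (Φ : 𝕜 × 𝕜 → 𝕜 × 𝕜) : 𝕜 × 𝕜 × 𝕜 → 𝕜 :=
  fun w => totalDeriv (fun z => (Φ z).2) w / totalDeriv (fun z => (Φ z).1) w

/-- The second derivative `d²u/dt² = D (du/dt) / D T` as a function of `(x, y, p, q)`. -/
noncomputable def transformedDeriv₂ (Φ : 𝕜 × 𝕜 → 𝕜 × 𝕜) : 𝕜 × 𝕜 × 𝕜 × 𝕜 → 𝕜 :=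
  fun j => totalDeriv₁ (transformedDeriv₁ Φ) j /
    totalDeriv (fun z => (Φ z).1) (j.1, j.2.1, j.2.2.1)

/-- The ODE `F (x, y, y', y'') = 0` is linearizable near the point `z`: some smooth point
transformation `(x, y) ↦ (t, u)` (a diffeomorphism from an open neighbourhood of `z` onto an open
set) carries it to `d²u/dt² = 0`, at all jets over this neighbourhood at which `du/dt` is
defined, that is, `D T ≠ 0`. -/
def LinearizableAt (F : 𝕜 × 𝕜 × 𝕜 × 𝕜 → 𝕜) (z : 𝕜 × 𝕜) : Prop :=
  ∃ Φ : OpenPartialHomeomorph (𝕜 × 𝕜) (𝕜 × 𝕜), z ∈ Φ.source ∧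
    ContDiffOn 𝕜 ∞ Φ Φ.source ∧ ContDiffOn 𝕜 ∞ Φ.symm Φ.target ∧
    ∀ x y p q : 𝕜, (x, y) ∈ Φ.source → totalDeriv (fun z => (Φ z).1) (x, y, p) ≠ 0 →
      (F (x, y, p, q) = 0 ↔ transformedDeriv₂ Φ (x, y, p, q) = 0)

end PointSymmetry

namespace PainleveVI

variable {𝕜 : Type*} [RCLike 𝕜]

/-- The points `(x, y)` at which the sixth Painlevé equation is regular. -/
def regularSet (𝕜 : Type*) [RCLike 𝕜] : Set (𝕜 × 𝕜) :=
  {z | z.1 ≠ 0 ∧ z.1 ≠ 1 ∧ z.2 ≠ 0 ∧ z.2 ≠ 1 ∧ z.2 ≠ z.1}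

/-- The right-hand side of the sixth Painlevé equation `y'' = rhs (x, y, y')`. -/
noncomputable def rhs (α β γ δ x y p : 𝕜) : 𝕜 :=
  1 / 2 * (1 / y + 1 / (y - 1) + 1 / (y - x)) * p ^ 2
    - (1 / x + 1 / (x - 1) + 1 / (y - x)) * p
    + y * (y - 1) * (y - x) / (x ^ 2 * (x - 1) ^ 2) *
      (α + β * (x / y ^ 2) + γ * ((x - 1) / (y - 1) ^ 2) + δ * (x * (x - 1) / (y - x) ^ 2))

/-- The sixth Painlevé equation in the form `F (x, y, y', y'') = 0`. -/
noncomputable def equation (α β γ δ : 𝕜) : 𝕜 × 𝕜 × 𝕜 × 𝕜 → 𝕜 :=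
  fun j => j.2.2.2 - rhs α β γ δ j.1 j.2.1 j.2.2.1

end PainleveVI

/-! Write the equation as y'' = a y'² + b y' + c and put P = y(y-1)(y-x). On the equation, (pr X)F
is a cubic polynomial in y', so X = ξ∂_x + φ∂_y is a symmetry exactly when four linear equations in
ξ, φ hold (`satisfiesDetermining_equation_iff`). Here b_y = 2a_x and a = P_y/(2P), and the function
W = a_xx - b a_x - (c_y - a c)_y (`obstruction`) decides part (i).

Part (i). Cross-differentiation of the determining equations gives W ξ_y = 0 and, once ξ_y = 0,
writes 2Wφ through ξ(x), its derivatives and a, b, c. On a vertical line W is rational in y, and it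
vanishes identically there only for the parameters (0, 0, 0, 1/2) (`params_of_obstruction_eq_zero`).
For all other parameters ξ_y = 0 and φ is a rational function of y. The quadratic determining
equation integrates to φ_y = aφ + C - ξ/(2(y-x)) with C independent of y. Its homogeneous solutions
are the multiples of √P, and comparing orders at the poles and at infinity shows that a rational
solution exists only if φ = 0 and ξ = 0 (`eq_zero_of_rational`, `eq_zero_of_determining`).

Part (ii). For the parameters (0, 0, 0, 1/2) the elliptic integral u = ∫ dy/√P satisfies, along
solutions, the Picard–Fuchs equation x(1-x)u'' + (1-2x)u' - u/4 = 0. Take a nonvanishing solution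
K(x) of it (`exists_elliptic`). Reduction of order, v = u/K and dt = dx/(x(x-1)K²), turns the
equation into d²v/dt² = 0 (`exists_flatCoordinates_of_elliptic`). This is the linearization. It also
carries the determining equations to those of d²v/dt² = 0 (`determiningEquations_iff`), whose
solutions are the eight-parameter family of projective vector fields
(`FlatEquations.exists_eq_flat`).

The differential identities are proved in an abstract commutative algebra with two derivations and
are then applied to smooth functions on an open set. -/

namespace PointSymmetry

/-! ### Smooth functions on an open set as an algebra with derivations. -/

section SmoothAlgebra

open TopologicalSpace

variable {𝕜 : Type*} [RCLike 𝕜]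

/-- The algebra of smooth functions on an open set of the plane. -/
def smoothAlgebra (U : Opens (𝕜 × 𝕜)) : Subalgebra 𝕜 (U → 𝕜) where
  carrier := {f | ∃ g : 𝕜 × 𝕜 → 𝕜, ContDiffOn 𝕜 ∞ g U ∧ ∀ z : U, f z = g z}
  mul_mem' := by
    rintro f f' ⟨g, hg, hf⟩ ⟨g', hg', hf'⟩
    exact ⟨fun z => g z * g' z, hg.mul hg', fun z => by simp [hf, hf']⟩
  add_mem' := by
    rintro f f' ⟨g, hg, hf⟩ ⟨g', hg', hf'⟩
    exact ⟨fun z => g z + g' z, hg.add hg', fun z => by simp [hf, hf']⟩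
  algebraMap_mem' c := ⟨fun _ => c, contDiffOn_const, fun _ => rfl⟩

namespace smoothAlgebra

variable {U : Opens (𝕜 × 𝕜)}

instance : CoeFun (smoothAlgebra U) fun _ => U → 𝕜 := ⟨Subtype.val⟩

/-- The element of `smoothAlgebra U` given by a smooth function. -/
def mk (g : 𝕜 × 𝕜 → 𝕜) (hg : ContDiffOn 𝕜 ∞ g U) : smoothAlgebra U :=
  ⟨fun z => g z, g, hg, fun _ => rfl⟩

@[simp] theorem mk_apply (g : 𝕜 × 𝕜 → 𝕜) (hg : ContDiffOn 𝕜 ∞ g U) (z : U) :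
    mk g hg z = g z := rfl

@[simp] theorem ofNat_apply (n : ℕ) [n.AtLeastTwo] (z : U) :
    (ofNat(n) : smoothAlgebra U) z = ofNat(n) := rfl

@[ext] theorem ext {f g : smoothAlgebra U} (h : ∀ z, f z = g z) : f = g :=
  Subtype.ext (funext h)

/-- A smooth extension of an element of `smoothAlgebra U` to the plane. -/
noncomputable def rep (f : smoothAlgebra U) : 𝕜 × 𝕜 → 𝕜 := f.2.choose

theorem contDiffOn_rep (f : smoothAlgebra U) : ContDiffOn 𝕜 ∞ (rep f) U := f.2.choose_spec.1

theorem rep_apply (f : smoothAlgebra U) (z : U) : (rep f) z = f z := (f.2.choose_spec.2 z).symm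

theorem mk_rep (f : smoothAlgebra U) : mk (rep f) (contDiffOn_rep f) = f := ext (rep_apply f)

theorem rep_mk_eventuallyEq (g : 𝕜 × 𝕜 → 𝕜) (hg : ContDiffOn 𝕜 ∞ g U) (z : U) :
    rep (mk g hg) =ᶠ[nhds (z : 𝕜 × 𝕜)] g :=
  Filter.eventually_of_mem (U.isOpen.mem_nhds z.2) fun w hw => rep_apply _ ⟨w, hw⟩

theorem contDiffOn_fderiv_apply {g : 𝕜 × 𝕜 → 𝕜} (hg : ContDiffOn 𝕜 ∞ g U) (v : 𝕜 × 𝕜) :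
    ContDiffOn 𝕜 ∞ (fun z => fderiv 𝕜 g z v) U :=
  (hg.fderiv_of_isOpen U.isOpen (by simp)).clm_apply contDiffOn_const

theorem differentiableAt_of_contDiffOn {g : 𝕜 × 𝕜 → 𝕜} (hg : ContDiffOn 𝕜 ∞ g U) (z : U) :
    DifferentiableAt 𝕜 g z :=
  (hg.contDiffAt (U.isOpen.mem_nhds z.2)).differentiableAt (by simp)

theorem fderiv_rep_mk (g : 𝕜 × 𝕜 → 𝕜) (hg : ContDiffOn 𝕜 ∞ g U) (z : U) :
    fderiv 𝕜 (rep (mk g hg)) z = fderiv 𝕜 g z :=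
  (rep_mk_eventuallyEq g hg z).fderiv_eq

/-- The directional derivative as a derivation of `smoothAlgebra U`. -/
noncomputable def der (v : 𝕜 × 𝕜) : Derivation 𝕜 (smoothAlgebra U) (smoothAlgebra U) :=
  Derivation.mk'
    { toFun := fun f => mk (fun z => fderiv 𝕜 (rep f) z v) (contDiffOn_fderiv_apply (contDiffOn_rep f) v)
      map_add' := fun f g => by
        ext z
        have h : f + g = mk (fun z => (rep f) z + (rep g) z)
          ((contDiffOn_rep f).add (contDiffOn_rep g)) := by ext z; simp [rep_apply]
        simp only [mk_apply, Subalgebra.coe_add, Pi.add_apply]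
        rw [h, fderiv_rep_mk, fderiv_fun_add (differentiableAt_of_contDiffOn (contDiffOn_rep f) z)
          (differentiableAt_of_contDiffOn (contDiffOn_rep g) z)]
        simp
      map_smul' := fun c f => by
        ext z
        have h : c • f = mk (fun z => c * (rep f) z) (contDiffOn_const.mul (contDiffOn_rep f)) := by
          ext z; simp [rep_apply]
        simp only [mk_apply, SetLike.val_smul, Pi.smul_apply, RingHom.id_apply]
        rw [h, fderiv_rep_mk,
          fderiv_const_mul (differentiableAt_of_contDiffOn (contDiffOn_rep f) z)]
        simp }
    fun f g => by
      ext z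
      have h : f * g = mk (fun z => (rep f) z * (rep g) z)
        ((contDiffOn_rep f).mul (contDiffOn_rep g)) := by ext z; simp [rep_apply]
      simp only [LinearMap.coe_mk, AddHom.coe_mk, mk_apply, smul_eq_mul, Subalgebra.coe_add,
        Pi.add_apply, Subalgebra.coe_mul, Pi.mul_apply]
      rw [h, fderiv_rep_mk, fderiv_fun_mul (differentiableAt_of_contDiffOn (contDiffOn_rep f) z)
        (differentiableAt_of_contDiffOn (contDiffOn_rep g) z)]
      simp [rep_apply]

/-- The derivation `∂_x`. -/
noncomputable abbrev derX (U : Opens (𝕜 × 𝕜)) :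
    Derivation 𝕜 (smoothAlgebra U) (smoothAlgebra U) := der (1, 0)

/-- The derivation `∂_y`. -/
noncomputable abbrev derY (U : Opens (𝕜 × 𝕜)) :
    Derivation 𝕜 (smoothAlgebra U) (smoothAlgebra U) := der (0, 1)

theorem der_apply (v : 𝕜 × 𝕜) (f : smoothAlgebra U) (z : U) :
    der v f z = fderiv 𝕜 (rep f) z v := rfl

theorem der_mk (v : 𝕜 × 𝕜) (g : 𝕜 × 𝕜 → 𝕜) (hg : ContDiffOn 𝕜 ∞ g U) :
    der v (mk g hg) = mk (fun z => fderiv 𝕜 g z v) (contDiffOn_fderiv_apply hg v) := by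
  ext z
  rw [der_apply, fderiv_rep_mk, mk_apply]

theorem der_comm (v w : 𝕜 × 𝕜) (f : smoothAlgebra U) : der v (der w f) = der w (der v f) := by
  obtain ⟨g, hg, rfl⟩ : ∃ g hg, mk g hg = f := ⟨_, _, mk_rep f⟩
  ext z
  have h := (hg.contDiffAt (U.isOpen.mem_nhds z.2))
  have hd : DifferentiableAt 𝕜 (fderiv 𝕜 g) z :=
    (h.fderiv_right (m := ∞) (by simp)).differentiableAt (by simp)
  have hs : IsSymmSndFDerivAt 𝕜 g z := h.isSymmSndFDerivAt (by simpa using WithTop.coe_le_coe.2 (le_top (a := (2 : ℕ∞))))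
  simp only [der_mk, mk_apply]
  rw [fderiv_clm_apply hd (differentiableAt_const _),
    fderiv_clm_apply hd (differentiableAt_const _)]
  simpa using hs v w

/-- The inverse of a nowhere vanishing smooth function. -/
noncomputable def inv (f : smoothAlgebra U) (hf : ∀ z, f z ≠ 0) : smoothAlgebra U :=
  mk (fun z => ((rep f) z)⁻¹) ((contDiffOn_rep f).inv fun z hz => by
    rw [rep_apply f ⟨z, hz⟩]; exact hf _)

theorem inv_apply (f : smoothAlgebra U) (hf : ∀ z, f z ≠ 0) (z : U) : inv f hf z = (f z)⁻¹ := by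
  simp [inv, rep_apply]

theorem mul_inv (f : smoothAlgebra U) (hf : ∀ z, f z ≠ 0) : f * inv f hf = 1 := by
  ext z
  simp [inv_apply, hf z]

/-- A smooth function on a connected open set whose partial derivatives vanish is constant. -/
theorem eq_algebraMap_of_der_eq_zero (hU : IsConnected (U : Set (𝕜 × 𝕜))) (f : smoothAlgebra U)
    (h1 : derX U f = 0) (h2 : derY U f = 0) :
    ∃ c : 𝕜, f = algebraMap 𝕜 _ c := by
  obtain ⟨c, hc⟩ := U.isOpen.exists_is_const_of_fderiv_eq_zero hU.isPreconnected
    (fun z hz => (differentiableAt_of_contDiffOn (contDiffOn_rep f) ⟨z, hz⟩).differentiableWithinAt)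
    (fun z hz => by
      have e1 : fderiv 𝕜 (rep f) z (1, 0) = 0 := congrFun (congrArg Subtype.val h1) ⟨z, hz⟩
      have e2 : fderiv 𝕜 (rep f) z (0, 1) = 0 := congrFun (congrArg Subtype.val h2) ⟨z, hz⟩
      ext
      · simpa using e1
      · simpa using e2)
  refine ⟨c, ext fun z => ?_⟩
  rw [← rep_apply, hc z z.2]
  rfl

end smoothAlgebra

end SmoothAlgebra

end PointSymmetry

/-! ### The determining equations in differential-algebraic form. -/

namespace PointSymmetry

/-- The determining equations of the point symmetries `ξ ∂_x + φ ∂_y` of the equation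
`y'' = a y'² + b y' + c`, in a commutative algebra with derivations `D = ∂_x` and `E = ∂_y`. -/
structure DeterminingEquations {k A : Type*} [Field k] [CommRing A] [Algebra k A]
    (D E : Derivation k A A) (a b c ξ φ : A) : Prop where
  cubic : E (E ξ) + a * E ξ = 0
  quadratic : E (E φ) - 2 * D (E ξ) - a * E φ - 2 * b * E ξ = ξ * D a + φ * E a
  linear : 2 * D (E φ) - D (D ξ) - b * D ξ - 3 * c * E ξ - 2 * a * D φ = ξ * D b + φ * E b
  constant : D (D φ) + (E φ - 2 * D ξ) * c - b * D φ = ξ * D c + φ * E c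

section Determining

open TopologicalSpace smoothAlgebra

variable {𝕜 : Type*} [RCLike 𝕜]

/-- The equation `y'' = a y'² + b y' + c` in the form `F (x, y, y', y'') = 0`. -/
def quadraticODE (a b c : 𝕜 × 𝕜 → 𝕜) : 𝕜 × 𝕜 × 𝕜 × 𝕜 → 𝕜 := fun j =>
  j.2.2.2 - (a (j.1, j.2.1) * j.2.2.1 ^ 2 + b (j.1, j.2.1) * j.2.2.1 + c (j.1, j.2.1))

theorem fderiv_apply_pair (g : 𝕜 × 𝕜 → 𝕜) (z : 𝕜 × 𝕜) (u v : 𝕜) :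
    fderiv 𝕜 g z (u, v) = u * fderiv 𝕜 g z (1, 0) + v * fderiv 𝕜 g z (0, 1) := by
  have h : ((u, v) : 𝕜 × 𝕜) = u • (1, 0) + v • (0, 1) := by simp
  rw [h, map_add, map_smul, map_smul, smul_eq_mul, smul_eq_mul]

theorem hasFDerivAt_comp_jet₁ {g : 𝕜 × 𝕜 → 𝕜} {w : 𝕜 × 𝕜 × 𝕜}
    (hg : DifferentiableAt 𝕜 g (w.1, w.2.1)) :
    HasFDerivAt (fun w : 𝕜 × 𝕜 × 𝕜 => g (w.1, w.2.1))
      ((fderiv 𝕜 g (w.1, w.2.1)).comp ((ContinuousLinearMap.fst 𝕜 𝕜 (𝕜 × 𝕜)).prod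
        ((ContinuousLinearMap.fst 𝕜 𝕜 𝕜).comp (ContinuousLinearMap.snd 𝕜 𝕜 (𝕜 × 𝕜))))) w :=
  hg.hasFDerivAt.comp (f := fun w : 𝕜 × 𝕜 × 𝕜 => (w.1, w.2.1)) w
    (hasFDerivAt_fst.prodMk (hasFDerivAt_fst.comp w hasFDerivAt_snd))

theorem hasFDerivAt_comp_jet₂ {g : 𝕜 × 𝕜 → 𝕜} {j : 𝕜 × 𝕜 × 𝕜 × 𝕜}
    (hg : DifferentiableAt 𝕜 g (j.1, j.2.1)) :
    HasFDerivAt (fun j : 𝕜 × 𝕜 × 𝕜 × 𝕜 => g (j.1, j.2.1))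
      ((fderiv 𝕜 g (j.1, j.2.1)).comp ((ContinuousLinearMap.fst 𝕜 𝕜 (𝕜 × 𝕜 × 𝕜)).prod
        ((ContinuousLinearMap.fst 𝕜 𝕜 (𝕜 × 𝕜)).comp
          (ContinuousLinearMap.snd 𝕜 𝕜 (𝕜 × 𝕜 × 𝕜))))) j :=
  hg.hasFDerivAt.comp (f := fun j : 𝕜 × 𝕜 × 𝕜 × 𝕜 => (j.1, j.2.1)) j
    (hasFDerivAt_fst.prodMk (hasFDerivAt_fst.comp j hasFDerivAt_snd))

theorem totalDeriv_eq (f : 𝕜 × 𝕜 → 𝕜) (w : 𝕜 × 𝕜 × 𝕜) :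
    totalDeriv f w = fderiv 𝕜 f (w.1, w.2.1) (1, 0) + w.2.2 * fderiv 𝕜 f (w.1, w.2.1) (0, 1) := by
  rw [totalDeriv, fderiv_apply_pair, one_mul]

theorem totalDeriv₁_totalDeriv {f : 𝕜 × 𝕜 → 𝕜} {x y p q : 𝕜}
    (h1 : DifferentiableAt 𝕜 (fun z => fderiv 𝕜 f z (1, 0)) (x, y))
    (h2 : DifferentiableAt 𝕜 (fun z => fderiv 𝕜 f z (0, 1)) (x, y)) :
    HasFDerivAt (totalDeriv f) (fderiv 𝕜 (totalDeriv f) (x, y, p)) (x, y, p) ∧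
    totalDeriv₁ (totalDeriv f) (x, y, p, q) =
      fderiv 𝕜 (fun z => fderiv 𝕜 f z (1, 0)) (x, y) (1, 0) +
      p * (fderiv 𝕜 (fun z => fderiv 𝕜 f z (1, 0)) (x, y) (0, 1) +
        fderiv 𝕜 (fun z => fderiv 𝕜 f z (0, 1)) (x, y) (1, 0)) +
      p ^ 2 * fderiv 𝕜 (fun z => fderiv 𝕜 f z (0, 1)) (x, y) (0, 1) +
      q * fderiv 𝕜 f (x, y) (0, 1) := by
  have hp : HasFDerivAt (fun w : 𝕜 × 𝕜 × 𝕜 => w.2.2)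
      ((ContinuousLinearMap.snd 𝕜 𝕜 𝕜).comp (ContinuousLinearMap.snd 𝕜 𝕜 (𝕜 × 𝕜))) (x, y, p) :=
    hasFDerivAt_snd.comp (x, y, p) hasFDerivAt_snd
  have H := (hasFDerivAt_comp_jet₁ (w := (x, y, p)) h1).add
    (hp.mul (hasFDerivAt_comp_jet₁ (w := (x, y, p)) h2))
  have H' := H.congr_of_eventuallyEq (Filter.Eventually.of_forall fun w => totalDeriv_eq f w)
  refine ⟨H'.differentiableAt.hasFDerivAt, ?_⟩
  rw [totalDeriv₁, H'.fderiv]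
  simp only [add_apply, ContinuousLinearMap.comp_apply, ContinuousLinearMap.prod_apply,
    ContinuousLinearMap.coe_fst', ContinuousLinearMap.coe_snd', smul_apply, smul_eq_mul]
  rw [fderiv_apply_pair _ _ 1 p, fderiv_apply_pair _ _ 1 p]
  ring

theorem fderiv_quadraticODE {a b c : 𝕜 × 𝕜 → 𝕜} {x y p q : 𝕜}
    (ha : DifferentiableAt 𝕜 a (x, y)) (hb : DifferentiableAt 𝕜 b (x, y))
    (hc : DifferentiableAt 𝕜 c (x, y)) (v : 𝕜 × 𝕜 × 𝕜 × 𝕜) :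
    fderiv 𝕜 (quadraticODE a b c) (x, y, p, q) v =
      v.2.2.2 - (fderiv 𝕜 a (x, y) (v.1, v.2.1) * p ^ 2 + fderiv 𝕜 b (x, y) (v.1, v.2.1) * p +
        fderiv 𝕜 c (x, y) (v.1, v.2.1) + (2 * a (x, y) * p + b (x, y)) * v.2.2.1) := by
  have hs : HasFDerivAt (fun j : 𝕜 × 𝕜 × 𝕜 × 𝕜 => j.2.2)
      ((ContinuousLinearMap.snd 𝕜 𝕜 (𝕜 × 𝕜)).comp (ContinuousLinearMap.snd 𝕜 𝕜 (𝕜 × 𝕜 × 𝕜)))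
      (x, y, p, q) := hasFDerivAt_snd.comp (x, y, p, q) hasFDerivAt_snd
  have hq := HasFDerivAt.comp (x, y, p, q) (hasFDerivAt_snd (𝕜 := 𝕜) (p := (p, q))) hs
  have hp := HasFDerivAt.comp (x, y, p, q) (hasFDerivAt_fst (𝕜 := 𝕜) (p := (p, q))) hs
  have H := hq.sub ((((hasFDerivAt_comp_jet₂ (j := (x, y, p, q)) ha).mul (hp.pow 2)).add
    ((hasFDerivAt_comp_jet₂ (j := (x, y, p, q)) hb).mul hp)).add
    (hasFDerivAt_comp_jet₂ (j := (x, y, p, q)) hc))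
  have H' : HasFDerivAt (quadraticODE a b c) _ (x, y, p, q) := H
  rw [H'.fderiv]
  simp
  ring

variable {U : Opens (𝕜 × 𝕜)} {a b c : 𝕜 × 𝕜 → 𝕜} {X : 𝕜 × 𝕜 → 𝕜 × 𝕜}

/-- Substituting q = a p² + b p + c makes every term polynomial in p: the highest power comes from
-p³ξ_yy and -3pqξ_y in the second prolongation coefficient. The four coefficients are the four
determining equations. The nested abstractions only abbreviate the derivations and the functions. -/
theorem fderiv_quadraticODE_prolong (ha : ContDiffOn 𝕜 ∞ a U) (hb : ContDiffOn 𝕜 ∞ b U)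
    (hc : ContDiffOn 𝕜 ∞ c U) (hX : ContDiffOn 𝕜 ∞ X U) (z : U) (p : 𝕜) :
    fderiv 𝕜 (quadraticODE a b c) (z.1.1, z.1.2, p, a z * p ^ 2 + b z * p + c z)
      (prolong X (z.1.1, z.1.2, p, a z * p ^ 2 + b z * p + c z)) =
      (fun D E : Derivation 𝕜 (smoothAlgebra U) (smoothAlgebra U) =>
        (fun a b c ξ φ : smoothAlgebra U =>
        (D (D φ) + (E φ - 2 * D ξ) * c - b * D φ - (ξ * D c + φ * E c)) z +
        p * (2 * D (E φ) - D (D ξ) - b * D ξ - 3 * c * E ξ - 2 * a * D φ -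
          (ξ * D b + φ * E b)) z +
        p ^ 2 * (E (E φ) - 2 * D (E ξ) - a * E φ - 2 * b * E ξ - (ξ * D a + φ * E a)) z -
        p ^ 3 * (E (E ξ) + a * E ξ) z)
        (mk a ha) (mk b hb) (mk c hc) (mk (fun z => (X z).1) hX.fst)
        (mk (fun z => (X z).2) hX.snd)) (derX U) (derY U) := by
  obtain ⟨⟨x, y⟩, hz⟩ := z
  have hd : ∀ {g : 𝕜 × 𝕜 → 𝕜}, ContDiffOn 𝕜 ∞ g U → DifferentiableAt 𝕜 g (x, y) :=
    fun hg => differentiableAt_of_contDiffOn hg ⟨(x, y), hz⟩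
  have hξ := fun q => totalDeriv₁_totalDeriv (p := p) (q := q)
    (hd (contDiffOn_fderiv_apply hX.fst (1, 0))) (hd (contDiffOn_fderiv_apply hX.fst (0, 1)))
  have hφ := fun q => totalDeriv₁_totalDeriv (p := p) (q := q)
    (hd (contDiffOn_fderiv_apply hX.snd (1, 0))) (hd (contDiffOn_fderiv_apply hX.snd (0, 1)))
  have hp : HasFDerivAt (fun w : 𝕜 × 𝕜 × 𝕜 => w.2.2)
      ((ContinuousLinearMap.snd 𝕜 𝕜 𝕜).comp (ContinuousLinearMap.snd 𝕜 𝕜 (𝕜 × 𝕜))) (x, y, p) :=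
    hasFDerivAt_snd.comp (x, y, p) hasFDerivAt_snd
  have h1 : ∀ q, totalDeriv₁ (prolongCoeff₁ X) (x, y, p, q) =
      totalDeriv₁ (totalDeriv fun z => (X z).2) (x, y, p, q) -
        (p * totalDeriv₁ (totalDeriv fun z => (X z).1) (x, y, p, q) +
          totalDeriv (fun z => (X z).1) (x, y, p) * q) := by
    intro q
    have H : HasFDerivAt (prolongCoeff₁ X) _ (x, y, p) := (hφ q).1.sub (hp.mul (hξ q).1)
    rw [totalDeriv₁, H.fderiv]
    simp [totalDeriv₁]
  have hs : ∀ {g : 𝕜 × 𝕜 → 𝕜}, ContDiffOn 𝕜 ∞ g U →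
      fderiv 𝕜 (fun z => fderiv 𝕜 g z (0, 1)) (x, y) (1, 0) =
      fderiv 𝕜 (fun z => fderiv 𝕜 g z (1, 0)) (x, y) (0, 1) := fun {g} hg => by
    have := congrFun (congrArg Subtype.val (der_comm (1, 0) (0, 1) (mk g hg))) ⟨(x, y), hz⟩
    simpa [der_mk] using this
  rw [fderiv_quadraticODE (hd ha) (hd hb) (hd hc)]
  simp only [prolong, prolongCoeff₂, h1, (hξ _).2, (hφ _).2, prolongCoeff₁, totalDeriv_eq,
    fderiv_apply_pair _ _ (X (x, y)).1, hs hX.fst, hs hX.snd]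
  simp [der_mk, hs hX.fst, hs hX.snd]
  ring

theorem satisfiesDetermining_quadraticODE_iff (ha : ContDiffOn 𝕜 ∞ a U)
    (hb : ContDiffOn 𝕜 ∞ b U) (hc : ContDiffOn 𝕜 ∞ c U) (hX : ContDiffOn 𝕜 ∞ X U) :
    SatisfiesDetermining (quadraticODE a b c) U X ↔
      DeterminingEquations (derX U) (derY U) (mk a ha) (mk b hb) (mk c hc)
        (mk (fun z => (X z).1) hX.fst) (mk (fun z => (X z).2) hX.snd) := by
  have hiff : SatisfiesDetermining (quadraticODE a b c) U X ↔ ∀ (z : U) (p : 𝕜),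
      fderiv 𝕜 (quadraticODE a b c) (z.1.1, z.1.2, p, a z * p ^ 2 + b z * p + c z)
        (prolong X (z.1.1, z.1.2, p, a z * p ^ 2 + b z * p + c z)) = 0 := by
    refine ⟨fun h z p => h _ _ _ _ z.2 (by simp [quadraticODE]), fun h x y p q hz hF => ?_⟩
    obtain rfl : q = a (x, y) * p ^ 2 + b (x, y) * p + c (x, y) := by
      simpa [quadraticODE, sub_eq_zero] using hF
    exact h ⟨(x, y), hz⟩ p
  rw [hiff]
  simp only [fderiv_quadraticODE_prolong ha hb hc hX]
  constructor
  · intro h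
    refine ⟨?_, ?_, ?_, ?_⟩ <;> refine ext fun z => ?_
    · rw [ZeroMemClass.coe_zero, Pi.zero_apply]
      -- The coefficients of a cubic polynomial in p are recovered by interpolation from its values
      -- at p = 2, 1, 0, -1.
      linear_combination (-1 / 6 : 𝕜) * h z 2 + (1 / 2 : 𝕜) * h z 1 - (1 / 2 : 𝕜) * h z 0 +
        (1 / 6 : 𝕜) * h z (-1)
    · rw [← sub_eq_zero, ← Pi.sub_apply, ← Subalgebra.coe_sub]
      linear_combination (1 / 2 : 𝕜) * h z 1 + (1 / 2 : 𝕜) * h z (-1) - h z 0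
    · rw [← sub_eq_zero, ← Pi.sub_apply, ← Subalgebra.coe_sub]
      linear_combination (-1 / 6 : 𝕜) * h z 2 + h z 1 - (1 / 2 : 𝕜) * h z 0 -
        (1 / 3 : 𝕜) * h z (-1)
    · rw [← sub_eq_zero, ← Pi.sub_apply, ← Subalgebra.coe_sub]
      linear_combination h z 0
  · rintro ⟨h1, h2, h3, h4⟩ z p
    rw [h1, sub_eq_zero.2 h2, sub_eq_zero.2 h3, sub_eq_zero.2 h4]
    simp

end Determining

end PointSymmetry

/-! ### Consequences of the determining equations by elimination. -/

namespace PointSymmetry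

namespace DeterminingEquations

variable {k A : Type*} [Field k] [CommRing A] [Algebra k A] {D E : Derivation k A A}
  {a b c ξ φ : A}

/-- If `b_y = 2 a_x`, then `ξ_y` is annihilated by the obstruction to linearizability. -/
theorem obstruction_mul (h : DeterminingEquations D E a b c ξ φ) (hDE : ∀ f, E (D f) = D (E f))
    (hb : E b = 2 * D a) :
    3 * ((D (D a) - b * D a - E (E c - a * c)) * E ξ) = 0 := by
  obtain ⟨h3, h2, h1, -⟩ := h
  have D2 : D (2 : A) = 0 := by exact_mod_cast D.map_natCast 2
  have E2 : E (2 : A) = 0 := by exact_mod_cast E.map_natCast 2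
  have E3 : E (3 : A) = 0 := by exact_mod_cast E.map_natCast 3
  have hbx : D (E b) = 2 * D (D a) := by rw [hb]; simp [D2]
  have hby : E (E b) = 2 * D (E a) := by rw [hb]; simp [E2, hDE]
  have h3x := congrArg D h3
  have h3xx := congrArg D h3x
  have h2x := congrArg D h2
  have h1y := congrArg E h1
  simp only [map_add, map_sub, Derivation.leibniz, smul_eq_mul, D2, E2, E3, hDE, map_zero, mul_zero,
    add_zero] at h3x h3xx h2x h1y
  -- The y-derivative of `linear` and twice the x-derivative of `quadratic` both contain 2φ_xyy.
  -- Their difference involves ξ_y only, since the remaining terms in φ cancel by b_y = 2a_x.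
  have hQ : 3 * (D (D (E ξ)) + D b * E ξ + b * D (E ξ) - (E c - a * c) * E ξ) = 0 := by
    linear_combination h1y - 2 * h2x + (D ξ + E φ) * hb + ξ * hbx + φ * hby + 3 * c * h3
  have hQy := congrArg E hQ
  simp only [map_add, map_sub, Derivation.leibniz, smul_eq_mul, E3, hDE, map_zero, mul_zero,
    add_zero] at hQy ⊢
  -- Applying ∂_y + a to this relation and using ξ_yy = -aξ_y removes all derivatives of ξ_y.
  linear_combination hQy + a * hQ - 3 * h3xx - 3 * b * h3x - 3 * D b * h3 +
    3 * (E c - a * c) * h3 - 3 * E ξ * hbx - 3 * D (E ξ) * hb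

/-- If `b_y = 2 a_x` and `ξ = ξ(x)`, then `φ` times the obstruction to linearizability is
expressed through `ξ` and its derivatives. -/
theorem obstruction_mul_snd (h : DeterminingEquations D E a b c ξ φ)
    (hDE : ∀ f, E (D f) = D (E f)) (hb : E b = 2 * D a) (hξ : E ξ = 0) :
    2 * (D (D a) - b * D a - E (E c - a * c)) * φ =
      -(D (D (D ξ)) + ξ * D (D b) + 2 * D b * D ξ + b * D (D ξ)
        - b * (D (D ξ) + ξ * D b + b * D ξ) + 2 * c * ξ * D a
        - 4 * D ξ * (E c - a * c) - 2 * ξ * (D (E c) - a * D c)) := by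
  obtain ⟨-, h2, h1, h0⟩ := h
  have D2 : D (2 : A) = 0 := by exact_mod_cast D.map_natCast 2
  have E2 : E (2 : A) = 0 := by exact_mod_cast E.map_natCast 2
  have hbx : D (E b) = 2 * D (D a) := by rw [hb]; simp [D2]
  simp only [hξ, map_zero, mul_zero, sub_zero] at h2 h1
  have h1x := congrArg D h1
  have h0y := congrArg E h0
  simp only [map_add, map_sub, Derivation.leibniz, smul_eq_mul, D2, E2, hDE, hξ, map_zero,
    mul_zero, add_zero] at h1x h0y ⊢
  -- Twice the y-derivative of `constant` minus the x-derivative of `linear` cancels φ_xxy. The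
  -- other three terms in the lower-order equations remove the derivatives of φ that remain.
  linear_combination 2 * h0y - h1x - 2 * a * h0 + b * h1 - 2 * c * h2 + D φ * hb - φ * hbx +
    b * φ * hb

/-- If `ξ = ξ(x)`, then `φ_y - a φ` has the `y`-derivative `a_x ξ`. -/
theorem snd_deriv (h : DeterminingEquations D E a b c ξ φ)
    (hξ : E ξ = 0) : E (E φ - a * φ) = ξ * D a := by
  have h2 := h.quadratic
  simp only [map_sub, Derivation.leibniz, smul_eq_mul, hξ, map_zero] at h2 ⊢
  linear_combination h2

end DeterminingEquations
end PointSymmetry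

/-! ### Rational solutions of the first-order equation with homogeneous solution √P. -/

namespace PainleveVI

section Polynomial

open Polynomial

/-- The polynomial `X (X - 1) (X - x)`. -/
noncomputable def branchPoly {K : Type*} [Field K] (x : K) : K[X] := X * (X - 1) * (X - C x)

theorem eval_branchPoly {K : Type*} [Field K] (x y : K) :
    (branchPoly x).eval y = y * (y - 1) * (y - x) := by simp [branchPoly]

theorem eval_derivative_branchPoly {K : Type*} [Field K] (x y : K) :
    (derivative (branchPoly x)).eval y = (y - 1) * (y - x) + y * (y - x) + y * (y - 1) := by
  simp [branchPoly]
  ring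

/-- The hypothesis says that f = M/N solves 2P f' = P' f + R. A pole of f of order m + 1 away from
the roots of P makes 2P f' the only term with a pole of order m + 2. At a root of P, which is
simple, the leading coefficients of 2P f' and P' f are in the ratio -2(m+1) : 1 and cannot cancel.
So f has no pole. -/
theorem natDegree_eq_zero_of_isCoprime {K : Type*} [Field K] [CharZero K] [IsAlgClosed K]
    {x : K} (hx0 : x ≠ 0) (hx1 : x ≠ 1) {M N R : K[X]} (hN : N ≠ 0) (hMN : IsCoprime M N)
    (h : 2 * branchPoly x * (derivative M * N - M * derivative N) =
      derivative (branchPoly x) * M * N + N ^ 2 * R) : N.natDegree = 0 := by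
  by_contra hdeg
  obtain ⟨e, he⟩ := IsAlgClosed.exists_root N (fun h0 => hdeg (natDegree_eq_zero_iff_degree_le_zero.2 h0.le))
  obtain ⟨N₁, hN₁, hndvd⟩ := N.exists_eq_pow_rootMultiplicity_mul_and_not_dvd hN e
  obtain ⟨m, hm⟩ : ∃ m, N.rootMultiplicity e = m + 1 :=
    Nat.exists_eq_succ_of_ne_zero ((rootMultiplicity_pos hN).2 he).ne'
  rw [hm] at hN₁
  have hN₁e : N₁.eval e ≠ 0 := fun h0 => hndvd (dvd_iff_isRoot.2 h0)
  have hMe : M.eval e ≠ 0 := by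
    obtain ⟨u, v, huv⟩ := hMN
    intro h0
    have := congrArg (eval e) huv
    simp [h0, he.eq_zero] at this
  have hpow : (X - C e) ^ (m + 1) ≠ 0 := pow_ne_zero _ (X_sub_C_ne_zero e)
  have hD : derivative N = (m + 1 : K[X]) * (X - C e) ^ m * N₁ + (X - C e) ^ (m + 1) * derivative N₁ := by
    rw [hN₁, derivative_mul, derivative_X_sub_C_pow]
    simp
  have hm0 : (m + 1 : K) ≠ 0 := by exact_mod_cast m.succ_ne_zero
  by_cases hP : (branchPoly x).eval e = 0
  · obtain ⟨P₁, hP₁⟩ := dvd_iff_isRoot.2 (show (branchPoly x).IsRoot e from hP)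
    have hP₁e : P₁.eval e ≠ 0 := by
      have hd := congrArg (fun p => eval e (derivative p)) hP₁
      simp only [derivative_mul, eval_derivative_branchPoly] at hd
      simp at hd
      rw [← hd]
      rw [eval_branchPoly] at hP
      rcases mul_eq_zero.1 hP with h1 | h1
      · rcases mul_eq_zero.1 h1 with h2 | h2
        · simp [h2, hx0]
        · obtain rfl : e = 1 := sub_eq_zero.1 h2
          simpa [sub_eq_zero] using hx1.symm
      · obtain rfl : e = x := sub_eq_zero.1 h1
        simp [hx0, sub_eq_zero, hx1]
    -- Both sides are divisible by (X - e)^(m+1); after division, evaluation at e leaves -(2(m+1) +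
    -- 1) P₁ M N₁.
    have key : (X - C e) ^ (m + 1) * (2 * (X - C e) * P₁ * derivative M * N₁
        - 2 * P₁ * M * ((m + 1 : K[X]) * N₁ + (X - C e) * derivative N₁)
        - (P₁ + (X - C e) * derivative P₁) * M * N₁ - N * N₁ * R) = 0 := by
      have hP' : derivative (branchPoly x) = P₁ + (X - C e) * derivative P₁ := by
        rw [hP₁, derivative_mul]; simp
      rw [hD, hP', hP₁] at h
      have hN2 : N ^ 2 = (X - C e) ^ (m + 1) * N₁ * N := by rw [← hN₁, sq]
      rw [hN2] at h
      linear_combination h + (P₁ * M  + (X - C e) * derivative P₁ * M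
        - 2 * (X - C e) * P₁ * derivative M) * hN₁
    have h0 := congrArg (eval e) ((mul_eq_zero.1 key).resolve_left hpow)
    simp [he.eq_zero] at h0
    have : (2 * (m + 1) + 1 : K) * (P₁.eval e * M.eval e * N₁.eval e) = 0 := by
      linear_combination -h0
    refine mul_ne_zero ?_ (mul_ne_zero (mul_ne_zero hP₁e hMe) hN₁e) this
    exact_mod_cast (2 * (m + 1)).succ_ne_zero
  · have hpow' : (X - C e) ^ m ≠ 0 := pow_ne_zero _ (X_sub_C_ne_zero e)
    -- Here only (X - e)^m divides; after division, evaluation at e leaves 2(m+1) P M N₁.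
    have key : (X - C e) ^ m * (2 * branchPoly x * M * (m + 1 : K[X]) * N₁ + (X - C e) *
        (2 * branchPoly x * M * derivative N₁ - 2 * branchPoly x * derivative M * N₁ +
          derivative (branchPoly x) * M * N₁ + N * N₁ * R)) = 0 := by
      rw [hD] at h
      have hN2 : N ^ 2 = (X - C e) ^ (m + 1) * N₁ * N := by rw [← hN₁, sq]
      rw [hN2] at h
      linear_combination -h - (- 2 * branchPoly x * derivative M
        + derivative (branchPoly x) * M) * hN₁
    have h0 := congrArg (eval e) ((mul_eq_zero.1 key).resolve_left hpow')
    simp [hMe, hN₁e, hP, hm0] at h0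

/-- Evaluation at the roots of P gives M(0) = M(1) = 0 and M(x) = s. A nonzero M therefore has
degree d ≥ 2, and the inhomogeneous term, of degree at most 3, does not reach the degree d + 2. The
leading coefficients give 2d = 3, which is impossible. -/
theorem eq_zero_of_polynomial {K : Type*} [Field K] [CharZero K]
    {x : K} (hx0 : x ≠ 0) (hx1 : x ≠ 1) {M : K[X]} {c s : K}
    (h : 2 * branchPoly x * derivative M = derivative (branchPoly x) * M +
      (2 * C c * branchPoly x - C s * (X * (X - 1)))) : M = 0 ∧ s = 0 := by
  have hM0 : M.eval 0 = 0 := by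
    have := congrArg (eval 0) h
    simpa [eval_branchPoly, eval_derivative_branchPoly, hx0] using this
  have hM1 : M.eval 1 = 0 := by
    have := congrArg (eval 1) h
    simpa [eval_branchPoly, eval_derivative_branchPoly, sub_eq_zero, hx1.symm] using this
  have hMx : M.eval x = s := by
    have := congrArg (eval x) h
    simp [eval_branchPoly, eval_derivative_branchPoly] at this
    have h2 : x * (x - 1) * (M.eval x - s) = 0 := by linear_combination -this
    simpa [sub_eq_zero, hx0, hx1] using h2
  have hM : M = 0 := by
    by_contra hne
    have hdeg : 2 ≤ M.natDegree := by
      obtain ⟨Q, hQ⟩ := dvd_iff_isRoot.2 (show M.IsRoot 0 from hM0)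
      have hQ1 : Q.eval 1 = 0 := by
        rw [hQ] at hM1; simpa using hM1
      obtain ⟨S, hS⟩ := dvd_iff_isRoot.2 (show Q.IsRoot 1 from hQ1)
      have hS0 : S ≠ 0 := by rintro rfl; simp [hS] at hQ; exact hne hQ
      rw [hQ, hS, natDegree_mul (X_sub_C_ne_zero _) (mul_ne_zero (X_sub_C_ne_zero _) hS0),
        natDegree_mul (X_sub_C_ne_zero _) hS0, natDegree_X_sub_C, natDegree_X_sub_C]
      omega
    obtain ⟨n, hn⟩ : ∃ n, M.natDegree = n + 2 := Nat.exists_eq_add_of_le' hdeg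
    have hP : branchPoly x = X ^ 3 - C (1 + x) * X ^ 2 + C x * X := by
      simp [branchPoly]; ring
    have hPd : (branchPoly x).natDegree ≤ 3 := by rw [hP]; compute_degree
    have hPc : (branchPoly x).coeff 3 = 1 := by rw [hP, coeff_add, coeff_sub, coeff_C_mul, coeff_C_mul]; simp [coeff_X, coeff_X_pow]
    have h1 := coeff_mul_add_eq_of_natDegree_le (dg := n + 1) hPd
      ((natDegree_derivative_le M).trans (by omega))
    have h2 := coeff_mul_add_eq_of_natDegree_le (df := 2) (dg := n + 2)
      ((natDegree_derivative_le (branchPoly x)).trans (by omega)) hn.le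
    have h3 : (2 * C c * branchPoly x - C s * (X * (X - 1))).coeff (3 + (n + 1)) = 0 := by
      refine coeff_eq_zero_of_natDegree_lt (lt_of_le_of_lt (b := 3) ?_ (by omega))
      rw [hP]
      compute_degree
    have hlead : M.coeff (n + 2) ≠ 0 := by
      rw [← hn]; exact leadingCoeff_ne_zero.2 hne
    have hcoeff := congrArg (coeff · (3 + (n + 1))) h
    rw [mul_assoc, show (2 : K[X]) = C 2 from rfl] at hcoeff
    simp only [coeff_add, coeff_C_mul, h1] at hcoeff
    rw [show (C 2 : K[X]) = 2 from rfl, h3] at hcoeff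
    rw [show 3 + (n + 1) = 2 + (n + 2) by ring, h2, coeff_derivative, coeff_derivative, hPc] at hcoeff
    -- With d = n + 2 the factor 2d - 3 is 2n + 1.
    have : (2 * n + 1 : K) * M.coeff (n + 2) = 0 := by
      push_cast at hcoeff
      linear_combination hcoeff
    exact mul_ne_zero (by exact_mod_cast (2 * n).succ_ne_zero) hlead this
  refine ⟨hM, ?_⟩
  rw [← hMx, hM, eval_zero]

theorem exists_isCoprime_of_ne_zero {R : Type*} [EuclideanDomain R] (p : R) {q : R}
    (hq : q ≠ 0) : ∃ g p₁ q₁, IsCoprime p₁ q₁ ∧ p = g * p₁ ∧ q = g * q₁ := by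
  classical
  let := EuclideanDomain.gcdMonoid R
  exact ⟨_, _, _, isCoprime_div_gcd_div_gcd hq,
    (EuclideanDomain.mul_div_cancel' (gcd_ne_zero_of_right hq) (gcd_dvd_left p q)).symm,
    (EuclideanDomain.mul_div_cancel' (gcd_ne_zero_of_right hq) (gcd_dvd_right p q)).symm⟩

/-- After cancelling the common factor, the pole analysis is made over the algebraic closure, where
a nonconstant denominator has a root; the degree of the denominator does not change under this
extension. -/
theorem eq_zero_of_rational {K : Type*} [Field K] [CharZero K]
    {x : K} (hx0 : x ≠ 0) (hx1 : x ≠ 1) {M N : K[X]} (hN : N ≠ 0) {c s : K}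
    (h : 2 * branchPoly x * (derivative M * N - M * derivative N) =
      derivative (branchPoly x) * M * N +
        N ^ 2 * (2 * C c * branchPoly x - C s * (X * (X - 1)))) : M = 0 ∧ s = 0 := by
  obtain ⟨g, M₁, N₁, hcop, hM₁, hN₁⟩ := exists_isCoprime_of_ne_zero M hN
  have hg : g ≠ 0 := by rintro h0; rw [h0, zero_mul] at hN₁; exact hN hN₁
  have hN₁0 : N₁ ≠ 0 := by rintro rfl; rw [mul_zero] at hN₁; exact hN hN₁
  have h' : 2 * branchPoly x * (derivative M₁ * N₁ - M₁ * derivative N₁) =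
      derivative (branchPoly x) * M₁ * N₁ +
        N₁ ^ 2 * (2 * C c * branchPoly x - C s * (X * (X - 1))) := by
    apply mul_left_cancel₀ (pow_ne_zero 2 hg)
    rw [hM₁, hN₁, derivative_mul, derivative_mul] at h
    linear_combination h
  let ι := algebraMap K (AlgebraicClosure K)
  have hdeg : N₁.natDegree = 0 := by
    have hmap : (branchPoly x).map ι = branchPoly (ι x) := by simp [branchPoly]
    have := natDegree_eq_zero_of_isCoprime (x := ι x) (M := M₁.map ι) (N := N₁.map ι)
      (R := (2 * C c * branchPoly x - C s * (X * (X - 1))).map ι)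
      (by simpa using hx0) (by simpa using fun h => hx1 (ι.injective (by simpa using h)))
      ((Polynomial.map_ne_zero_iff ι.injective).2 hN₁0)
      (hcop.map (mapRingHom ι)) (by
        have := congrArg (Polynomial.map ι) h'
        simp only [← hmap]
        simpa [derivative_map] using this)
    rwa [natDegree_map] at this
  obtain ⟨d, rfl⟩ := natDegree_eq_zero.1 hdeg
  have hd : d ≠ 0 := by rintro rfl; simp at hN₁0
  obtain ⟨h1, h2⟩ := eq_zero_of_polynomial hx0 hx1 (M := M₁) (c := c * d) (s := s * d) (by
    apply mul_left_cancel₀ hN₁0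
    simp only [derivative_C, mul_zero, sub_zero] at h'
    rw [C_mul, C_mul]
    linear_combination h')
  exact ⟨by rw [hM₁, h1, mul_zero], by simpa [hd] using h2⟩

end Polynomial
end PainleveVI

/-! ### The coefficients of the sixth Painlevé equation and its obstruction. -/

namespace PainleveVI

open PointSymmetry TopologicalSpace smoothAlgebra

variable {𝕜 : Type*} [RCLike 𝕜]

/-- The coefficient of `y'²` in the sixth Painlevé equation. -/
noncomputable def coeffA (z : 𝕜 × 𝕜) : 𝕜 := 1 / 2 * (1 / z.2 + 1 / (z.2 - 1) + 1 / (z.2 - z.1))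

/-- The coefficient of `y'` in the sixth Painlevé equation. -/
noncomputable def coeffB (z : 𝕜 × 𝕜) : 𝕜 := -(1 / z.1 + 1 / (z.1 - 1) + 1 / (z.2 - z.1))

/-- The term of the sixth Painlevé equation that does not depend on `y'`. -/
noncomputable def coeffC (α β γ δ : 𝕜) (z : 𝕜 × 𝕜) : 𝕜 :=
  z.2 * (z.2 - 1) * (z.2 - z.1) / (z.1 ^ 2 * (z.1 - 1) ^ 2) *
    (α + β * (z.1 / z.2 ^ 2) + γ * ((z.1 - 1) / (z.2 - 1) ^ 2) +
      δ * (z.1 * (z.1 - 1) / (z.2 - z.1) ^ 2))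

theorem equation_eq_quadraticODE (α β γ δ : 𝕜) :
    equation α β γ δ = quadraticODE coeffA coeffB (coeffC α β γ δ) := by
  ext j
  simp only [equation, rhs, quadraticODE, coeffA, coeffB, coeffC]
  ring

theorem isOpen_regularSet : IsOpen (regularSet 𝕜) := by
  have h1 : Continuous fun z : 𝕜 × 𝕜 => z.1 := continuous_fst
  have h2 : Continuous fun z : 𝕜 × 𝕜 => z.2 := continuous_snd
  exact (isOpen_ne_fun h1 continuous_const).inter ((isOpen_ne_fun h1 continuous_const).inter
    ((isOpen_ne_fun h2 continuous_const).inter ((isOpen_ne_fun h2 continuous_const).inter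
      (isOpen_ne_fun h2 h1))))

section Coordinates

variable {U : Opens (𝕜 × 𝕜)}

/-- The coordinate function `x`. -/
noncomputable def coordX (U : Opens (𝕜 × 𝕜)) : smoothAlgebra U := mk (fun z => z.1) contDiffOn_fst

/-- The coordinate function `y`. -/
noncomputable def coordY (U : Opens (𝕜 × 𝕜)) : smoothAlgebra U := mk (fun z => z.2) contDiffOn_snd

@[simp] theorem coordX_apply (z : U) : coordX U z = z.1.1 := rfl
@[simp] theorem coordY_apply (z : U) : coordY U z = z.1.2 := rfl

theorem der_coordX (v : 𝕜 × 𝕜) : der v (coordX U) = algebraMap 𝕜 _ v.1 := by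
  rw [coordX, der_mk]
  ext z
  simp [show (fun z : 𝕜 × 𝕜 => z.1) = Prod.fst from rfl, fderiv_fst]

theorem der_coordY (v : 𝕜 × 𝕜) : der v (coordY U) = algebraMap 𝕜 _ v.2 := by
  rw [coordY, der_mk]
  ext z
  simp [show (fun z : 𝕜 × 𝕜 => z.2) = Prod.snd from rfl, fderiv_snd]

variable (hU : (U : Set (𝕜 × 𝕜)) ⊆ regularSet 𝕜)

theorem coordX_ne_zero (hU : (U : Set (𝕜 × 𝕜)) ⊆ regularSet 𝕜) (z : U) : coordX U z ≠ 0 := (hU z.2).1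

theorem coordY_ne_zero (hU : (U : Set (𝕜 × 𝕜)) ⊆ regularSet 𝕜) (z : U) : coordY U z ≠ 0 := (hU z.2).2.2.1

/-- The function `1 / x`. -/
noncomputable def invX (hU : (U : Set (𝕜 × 𝕜)) ⊆ regularSet 𝕜) : smoothAlgebra U := smoothAlgebra.inv (coordX U) (coordX_ne_zero hU)

/-- The function `1 / (x - 1)`. -/
noncomputable def invX₁ (hU : (U : Set (𝕜 × 𝕜)) ⊆ regularSet 𝕜) : smoothAlgebra U :=
  smoothAlgebra.inv (coordX U - 1) fun z => sub_ne_zero.2 (hU z.2).2.1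

/-- The function `1 / y`. -/
noncomputable def invY (hU : (U : Set (𝕜 × 𝕜)) ⊆ regularSet 𝕜) : smoothAlgebra U := smoothAlgebra.inv (coordY U) (coordY_ne_zero hU)

/-- The function `1 / (y - 1)`. -/
noncomputable def invY₁ (hU : (U : Set (𝕜 × 𝕜)) ⊆ regularSet 𝕜) : smoothAlgebra U :=
  smoothAlgebra.inv (coordY U - 1) fun z => sub_ne_zero.2 (hU z.2).2.2.2.1

/-- The function `1 / (y - x)`. -/
noncomputable def invYX (hU : (U : Set (𝕜 × 𝕜)) ⊆ regularSet 𝕜) : smoothAlgebra U :=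
  smoothAlgebra.inv (coordY U - coordX U) fun z => sub_ne_zero.2 (hU z.2).2.2.2.2

@[simp] theorem invX_apply (z : U) : invX hU z = (z.1.1)⁻¹ := inv_apply _ _ z
@[simp] theorem invX₁_apply (z : U) : invX₁ hU z = (z.1.1 - 1)⁻¹ := inv_apply _ _ z
@[simp] theorem invY_apply (z : U) : invY hU z = (z.1.2)⁻¹ := inv_apply _ _ z
@[simp] theorem invY₁_apply (z : U) : invY₁ hU z = (z.1.2 - 1)⁻¹ := inv_apply _ _ z
@[simp] theorem invYX_apply (z : U) : invYX hU z = (z.1.2 - z.1.1)⁻¹ := inv_apply _ _ z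

theorem der_inv (v : 𝕜 × 𝕜) (f : smoothAlgebra U) (hf : ∀ z, f z ≠ 0) :
    der v (inv f hf) = -(inv f hf) ^ 2 * der v f := by
  rw [(der v).leibniz_of_mul_eq_one (b := f) (by rw [mul_comm, smoothAlgebra.mul_inv]), smul_eq_mul]

theorem derX_coordX : derX U (coordX U) = 1 := by simp [der_coordX]
theorem derY_coordX : derY U (coordX U) = 0 := by simp [der_coordX]
theorem derX_coordY : derX U (coordY U) = 0 := by simp [der_coordY]
theorem derY_coordY : derY U (coordY U) = 1 := by simp [der_coordY]

theorem derX_invX : derX U (invX hU) = -invX hU ^ 2 := by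
  rw [invX, der_inv, derX_coordX, mul_one]
theorem derY_invX : derY U (invX hU) = 0 := by rw [invX, der_inv, derY_coordX, mul_zero]
theorem derX_invX₁ : derX U (invX₁ hU) = -invX₁ hU ^ 2 := by
  rw [invX₁, der_inv, map_sub, derX_coordX, Derivation.map_one_eq_zero, sub_zero, mul_one]
theorem derY_invX₁ : derY U (invX₁ hU) = 0 := by
  rw [invX₁, der_inv, map_sub, derY_coordX, Derivation.map_one_eq_zero, sub_zero, mul_zero]
theorem derX_invY : derX U (invY hU) = 0 := by rw [invY, der_inv, derX_coordY, mul_zero]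
theorem derY_invY : derY U (invY hU) = -invY hU ^ 2 := by
  rw [invY, der_inv, derY_coordY, mul_one]
theorem derX_invY₁ : derX U (invY₁ hU) = 0 := by
  rw [invY₁, der_inv, map_sub, derX_coordY, Derivation.map_one_eq_zero, sub_zero, mul_zero]
theorem derY_invY₁ : derY U (invY₁ hU) = -invY₁ hU ^ 2 := by
  rw [invY₁, der_inv, map_sub, derY_coordY, Derivation.map_one_eq_zero, sub_zero, mul_one]
theorem derX_invYX : derX U (invYX hU) = invYX hU ^ 2 := by
  rw [invYX, der_inv, map_sub, derX_coordX, derX_coordY]; ring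
theorem derY_invYX : derY U (invYX hU) = -invYX hU ^ 2 := by
  rw [invYX, der_inv, map_sub, derY_coordX, derY_coordY]; ring

/-- The coefficient of `y'²` as an element of `smoothAlgebra U`. -/
noncomputable def smoothA (hU : (U : Set (𝕜 × 𝕜)) ⊆ regularSet 𝕜) : smoothAlgebra U :=
  algebraMap 𝕜 _ (1 / 2) * (invY hU + invY₁ hU + invYX hU)

/-- The coefficient of `y'` as an element of `smoothAlgebra U`. -/
noncomputable def smoothB (hU : (U : Set (𝕜 × 𝕜)) ⊆ regularSet 𝕜) : smoothAlgebra U := -(invX hU + invX₁ hU + invYX hU)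

/-- The coefficient of `y'⁰` as an element of `smoothAlgebra U`. -/
noncomputable def smoothC (hU : (U : Set (𝕜 × 𝕜)) ⊆ regularSet 𝕜) (α β γ δ : 𝕜) : smoothAlgebra U :=
  invX hU ^ 2 * invX₁ hU ^ 2 *
    (algebraMap 𝕜 _ α * (coordY U * (coordY U - 1) * (coordY U - coordX U)) +
      algebraMap 𝕜 _ β * (coordX U * ((coordY U - 1) * (coordY U - coordX U)) * invY hU) +
      algebraMap 𝕜 _ γ * ((coordX U - 1) * (coordY U * (coordY U - coordX U)) * invY₁ hU) +
      algebraMap 𝕜 _ δ * (coordX U * (coordX U - 1) * (coordY U * (coordY U - 1)) * invYX hU))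

@[simp] theorem algebraMap_apply' (c : 𝕜) (z : U) : (algebraMap 𝕜 (smoothAlgebra U) c) z = c := rfl

theorem smoothA_apply (z : U) : smoothA hU z = coeffA z.1 := by
  simp [smoothA, coeffA]

theorem smoothB_apply (z : U) : smoothB hU z = coeffB z.1 := by
  simp [smoothB, coeffB]

theorem smoothC_apply (α β γ δ : 𝕜) (z : U) : smoothC hU α β γ δ z = coeffC α β γ δ z.1 := by
  obtain ⟨h0, h1, h2, h3, h4⟩ := hU z.2
  have h1 := sub_ne_zero.2 h1
  have h3 := sub_ne_zero.2 h3
  have h4 := sub_ne_zero.2 h4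
  simp [smoothC, coeffC]
  field_simp

theorem derX_smoothA :
    derX U (smoothA hU) = algebraMap 𝕜 _ (1 / 2) * invYX hU ^ 2 := by
  simp [smoothA, derX_invY, derX_invY₁, derX_invYX]

theorem derY_smoothB_eq : derY U (smoothB hU) = invYX hU ^ 2 := by
  simp [smoothB, derY_invX, derY_invX₁, derY_invYX]

theorem derX_derX_smoothA :
    derX U (derX U (smoothA hU)) = invYX hU ^ 3 := by
  have h2 : algebraMap 𝕜 (smoothAlgebra U) (1 / 2) * 2 = 1 := by ext z; simp
  rw [derX_smoothA]
  simp only [Derivation.leibniz, Derivation.leibniz_pow, Derivation.map_algebraMap, derX_invYX,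
    smul_eq_mul, nsmul_eq_mul]
  push_cast
  linear_combination invYX hU ^ 3 * h2

theorem derY_smoothB : derY U (smoothB hU) = 2 * derX U (smoothA hU) := by
  rw [derY_smoothB_eq, derX_smoothA]
  ext z
  simp

/-- The obstruction to linearizability of the sixth Painlevé equation. -/
noncomputable def obstruction (hU : (U : Set (𝕜 × 𝕜)) ⊆ regularSet 𝕜) (α β γ δ : 𝕜) :
    smoothAlgebra U :=
  derX U (derX U (smoothA hU)) - smoothB hU * derX U (smoothA hU) -
    derY U (derY U (smoothC hU α β γ δ) - smoothA hU * smoothC hU α β γ δ)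

/-- This is the expansion of W in partial fractions with respect to y. The poles at 0, 1 and x carry
β, γ and 1/2 - δ, and the polynomial part carries α. -/
theorem obstruction_apply (α β γ δ : 𝕜) (z : U) :
    obstruction hU α β γ δ z = (1 / 2 - δ) * (3 / (z.1.2 - z.1.1) ^ 3 +
      (2 * z.1.1 - 1) / (z.1.1 * (z.1.1 - 1)) / (z.1.2 - z.1.1) ^ 2) -
      (α * (3 * z.1.2 - 1 - z.1.1) +
        β * z.1.1 * (3 * z.1.1 / z.1.2 ^ 3 - (1 + z.1.1) / z.1.2 ^ 2) +
        γ * (z.1.1 - 1) * ((2 - z.1.1) / (z.1.2 - 1) ^ 2 -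
          3 * (z.1.1 - 1) / (z.1.2 - 1) ^ 3)) / (z.1.1 ^ 2 * (z.1.1 - 1) ^ 2) := by
  obtain ⟨h0, h1, h2, h3, h4⟩ := hU z.2
  have h1 := sub_ne_zero.2 h1
  have h3 := sub_ne_zero.2 h3
  have h4 := sub_ne_zero.2 h4
  rw [obstruction, derX_derX_smoothA, derX_smoothA]
  simp only [smoothC, smoothA, smoothB, Derivation.leibniz, Derivation.leibniz_pow, map_add,
    map_sub, Derivation.map_algebraMap, derY_coordX, derY_coordY, derY_invX, derY_invX₁,
    derY_invY, derY_invY₁, derY_invYX, smul_eq_mul, smul_zero, Derivation.map_one_eq_zero,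
    mul_zero, add_zero, map_neg, sub_zero, mul_one]
  simp
  field_simp
  ring

end Coordinates
end PainleveVI

/-! ### Restriction to vertical lines and rationality in y. -/

namespace PointSymmetry.smoothAlgebra

open TopologicalSpace Polynomial

variable {𝕜 : Type*} [RCLike 𝕜] {U : Opens (𝕜 × 𝕜)}

theorem hasDerivAt_rep_snd (f : smoothAlgebra U) {x y : 𝕜} (h : (x, y) ∈ U) :
    HasDerivAt (fun y => rep f (x, y)) (derY U f ⟨(x, y), h⟩) y := by
  have h1 := (differentiableAt_of_contDiffOn (contDiffOn_rep f) ⟨(x, y), h⟩).hasFDerivAt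
  have h2 : HasDerivAt (fun y : 𝕜 => (x, y)) ((0, 1) : 𝕜 × 𝕜) y :=
    (hasDerivAt_const y x).prodMk (hasDerivAt_id y)
  exact h1.comp_hasDerivAt y h2

theorem eq_of_derY_eq_zero {f : smoothAlgebra U} {x : 𝕜} {s : Set 𝕜}
    (hso : IsOpen s) (hsc : IsPreconnected s) (hs : ∀ y ∈ s, (x, y) ∈ U)
    (hf : ∀ y (hy : y ∈ s), derY U f ⟨(x, y), hs y hy⟩ = 0) :
    ∃ c, ∀ y (hy : y ∈ s), f ⟨(x, y), hs y hy⟩ = c := by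
  obtain ⟨c, hc⟩ := hso.exists_is_const_of_deriv_eq_zero hsc
    (fun y hy => (hasDerivAt_rep_snd f (hs y hy)).differentiableAt.differentiableWithinAt)
    (fun y hy => by rw [(hasDerivAt_rep_snd f (hs y hy)).deriv]; exact hf y hy)
  exact ⟨c, fun y hy => by rw [← hc y hy, ← rep_apply]⟩

/-- Zeros of N do no harm: if f were nonzero at y, it would be nonzero nearby by continuity, and N
would have infinitely many roots. -/
theorem eq_zero_of_mul_eval_eq_zero {f : smoothAlgebra U} {x : 𝕜} {s : Set 𝕜}
    (hso : IsOpen s) (hs : ∀ y ∈ s, (x, y) ∈ U) {N : 𝕜[X]} (hN : N ≠ 0)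
    (h : ∀ y (hy : y ∈ s), f ⟨(x, y), hs y hy⟩ * N.eval y = 0) {y : 𝕜} (hy : y ∈ s) :
    f ⟨(x, y), hs y hy⟩ = 0 := by
  by_contra hne
  have hc := (hasDerivAt_rep_snd f (hs y hy)).continuousAt
  have hev : ∀ᶠ w in nhds y, rep f (x, w) ≠ 0 :=
    hc.eventually_ne (by rw [rep_apply f ⟨(x, y), hs y hy⟩]; exact hne)
  refine hN (eq_zero_of_infinite_isRoot N ((infinite_of_mem_nhds y
    (Filter.inter_mem hev (hso.mem_nhds hy))).mono fun w hw => ?_))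
  have h0 := h w hw.2
  rw [← rep_apply] at h0
  exact (mul_eq_zero.1 h0).resolve_left hw.1

end PointSymmetry.smoothAlgebra

namespace PainleveVI

open PointSymmetry TopologicalSpace smoothAlgebra Polynomial

variable {𝕜 : Type*} [RCLike 𝕜] {U : Opens (𝕜 × 𝕜)}

/-- The smooth functions whose restriction to the set `{x} × s` is a rational function with poles
at most at the branch points. -/
noncomputable def rationalAt (x : 𝕜) (s : Set 𝕜) (hs : ∀ y ∈ s, (x, y) ∈ U) :
    Subalgebra 𝕜 (smoothAlgebra U) where
  carrier := {f | ∃ (Q : 𝕜[X]) (n : ℕ), ∀ y (hy : y ∈ s),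
    f ⟨(x, y), hs y hy⟩ * (branchPoly x).eval y ^ n = Q.eval y}
  mul_mem' := by
    rintro f g ⟨Q, n, hQ⟩ ⟨R, m, hR⟩
    refine ⟨Q * R, n + m, fun y hy => ?_⟩
    rw [eval_mul, ← hQ y hy, ← hR y hy, Subalgebra.coe_mul, Pi.mul_apply]
    ring
  add_mem' := by
    rintro f g ⟨Q, n, hQ⟩ ⟨R, m, hR⟩
    refine ⟨Q * branchPoly x ^ m + R * branchPoly x ^ n, n + m, fun y hy => ?_⟩
    rw [eval_add, eval_mul, eval_mul, ← hQ y hy, ← hR y hy, Subalgebra.coe_add, Pi.add_apply,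
      eval_pow, eval_pow]
    ring
  algebraMap_mem' c := ⟨C c, 0, fun y hy => by simp⟩

theorem mem_rationalAt_of_const {x : 𝕜} {s : Set 𝕜} {hs : ∀ y ∈ s, (x, y) ∈ U}
    {f : smoothAlgebra U} {c : 𝕜} (h : ∀ y (hy : y ∈ s), f ⟨(x, y), hs y hy⟩ = c) :
    f ∈ rationalAt x s hs := ⟨C c, 0, fun y hy => by simp [h y hy]⟩

/-- The algebra of rational functions generated by the coordinates and the inverses of
`x`, `x - 1`, `y`, `y - 1` and `y - x`. -/
noncomputable def coordAlgebra (hU : (U : Set (𝕜 × 𝕜)) ⊆ regularSet 𝕜) :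
    Subalgebra 𝕜 (smoothAlgebra U) :=
  Algebra.adjoin 𝕜 {coordX U, coordY U, invX hU, invX₁ hU, invY hU, invY₁ hU, invYX hU}

variable (hU : (U : Set (𝕜 × 𝕜)) ⊆ regularSet 𝕜)

theorem coordX_mem : coordX U ∈ coordAlgebra hU := Algebra.subset_adjoin (by simp)
theorem coordY_mem : coordY U ∈ coordAlgebra hU := Algebra.subset_adjoin (by simp)
theorem invX_mem : invX hU ∈ coordAlgebra hU := Algebra.subset_adjoin (by simp)
theorem invX₁_mem : invX₁ hU ∈ coordAlgebra hU := Algebra.subset_adjoin (by simp)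
theorem invY_mem : invY hU ∈ coordAlgebra hU := Algebra.subset_adjoin (by simp)
theorem invY₁_mem : invY₁ hU ∈ coordAlgebra hU := Algebra.subset_adjoin (by simp)
theorem invYX_mem : invYX hU ∈ coordAlgebra hU := Algebra.subset_adjoin (by simp)

/-- On a vertical line x is a constant, and y, y - 1 and y - x divide P, so a power of P clears
every denominator. -/
theorem coordAlgebra_le_rationalAt (x : 𝕜) (s : Set 𝕜) (hs : ∀ y ∈ s, (x, y) ∈ U) :
    coordAlgebra hU ≤ rationalAt x s hs := by
  refine Algebra.adjoin_le ?_
  have hy0 : ∀ y ∈ s, y ≠ 0 := fun y hy => (hU (hs y hy)).2.2.1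
  have hy1 : ∀ y ∈ s, y - 1 ≠ 0 := fun y hy => sub_ne_zero.2 (hU (hs y hy)).2.2.2.1
  have hyx : ∀ y ∈ s, y - x ≠ 0 := fun y hy => sub_ne_zero.2 (hU (hs y hy)).2.2.2.2
  rintro f (rfl | rfl | rfl | rfl | rfl | rfl | rfl)
  · exact mem_rationalAt_of_const (c := x) fun y hy => rfl
  · exact ⟨X, 0, fun y hy => by simp⟩
  · exact mem_rationalAt_of_const (c := x⁻¹) fun y hy => by simp
  · exact mem_rationalAt_of_const (c := (x - 1)⁻¹) fun y hy => by simp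
  · refine ⟨(X - 1) * (X - C x), 1, fun y hy => ?_⟩
    have := hy0 y hy
    simp [eval_branchPoly]
    field_simp
  · refine ⟨X * (X - C x), 1, fun y hy => ?_⟩
    have := hy1 y hy
    simp [eval_branchPoly]
    field_simp
  · refine ⟨X * (X - 1), 1, fun y hy => ?_⟩
    have := hyx y hy
    simp [eval_branchPoly]
    field_simp

theorem derivation_mem_coordAlgebra
    {D : Derivation 𝕜 (smoothAlgebra U) (smoothAlgebra U)}
    (h : ∀ f ∈ ({coordX U, coordY U, invX hU, invX₁ hU, invY hU, invY₁ hU, invYX hU} :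
      Set (smoothAlgebra U)), D f ∈ coordAlgebra hU) {f : smoothAlgebra U}
    (hf : f ∈ coordAlgebra hU) : D f ∈ coordAlgebra hU := by
  induction hf using Algebra.adjoin_induction with
  | mem f hf => exact h f hf
  | algebraMap c => rw [Derivation.map_algebraMap]; exact zero_mem _
  | add f g _ _ hf hg => rw [map_add]; exact add_mem hf hg
  | mul f g hf' hg' hf hg =>
    rw [Derivation.leibniz, smul_eq_mul, smul_eq_mul]
    exact add_mem (mul_mem hf' hg) (mul_mem hg' hf)

theorem derX_mem_coordAlgebra {f : smoothAlgebra U} (hf : f ∈ coordAlgebra hU) :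
    derX U f ∈ coordAlgebra hU := by
  refine derivation_mem_coordAlgebra hU ?_ hf
  rintro f (rfl | rfl | rfl | rfl | rfl | rfl | rfl)
  · rw [derX_coordX]; exact one_mem _
  · rw [derX_coordY]; exact zero_mem _
  · rw [derX_invX]; exact neg_mem (pow_mem (invX_mem hU) 2)
  · rw [derX_invX₁]; exact neg_mem (pow_mem (invX₁_mem hU) 2)
  · rw [derX_invY]; exact zero_mem _
  · rw [derX_invY₁]; exact zero_mem _
  · rw [derX_invYX]; exact pow_mem (invYX_mem hU) 2

theorem derY_mem_coordAlgebra {f : smoothAlgebra U} (hf : f ∈ coordAlgebra hU) :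
    derY U f ∈ coordAlgebra hU := by
  refine derivation_mem_coordAlgebra hU ?_ hf
  rintro f (rfl | rfl | rfl | rfl | rfl | rfl | rfl)
  · rw [derY_coordX]; exact zero_mem _
  · rw [derY_coordY]; exact one_mem _
  · rw [derY_invX]; exact zero_mem _
  · rw [derY_invX₁]; exact zero_mem _
  · rw [derY_invY]; exact neg_mem (pow_mem (invY_mem hU) 2)
  · rw [derY_invY₁]; exact neg_mem (pow_mem (invY₁_mem hU) 2)
  · rw [derY_invYX]; exact neg_mem (pow_mem (invYX_mem hU) 2)

theorem smoothA_mem : smoothA hU ∈ coordAlgebra hU :=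
  mul_mem (algebraMap_mem _ _) (add_mem (add_mem (invY_mem hU) (invY₁_mem hU)) (invYX_mem hU))

theorem smoothB_mem : smoothB hU ∈ coordAlgebra hU :=
  neg_mem (add_mem (add_mem (invX_mem hU) (invX₁_mem hU)) (invYX_mem hU))

theorem smoothC_mem (α β γ δ : 𝕜) : smoothC hU α β γ δ ∈ coordAlgebra hU := by
  have hx := coordX_mem hU
  have hy := coordY_mem hU
  have hx1 := sub_mem hx (one_mem _)
  have hy1 := sub_mem hy (one_mem _)
  have hyx := sub_mem hy hx
  have hc := fun c => algebraMap_mem (coordAlgebra hU) c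
  exact mul_mem (mul_mem (pow_mem (invX_mem hU) 2) (pow_mem (invX₁_mem hU) 2))
    (add_mem (add_mem (add_mem (mul_mem (hc α) (mul_mem (mul_mem hy hy1) hyx))
      (mul_mem (hc β) (mul_mem (mul_mem hx (mul_mem hy1 hyx)) (invY_mem hU))))
      (mul_mem (hc γ) (mul_mem (mul_mem hx1 (mul_mem hy hyx)) (invY₁_mem hU))))
      (mul_mem (hc δ) (mul_mem (mul_mem (mul_mem hx hx1) (mul_mem hy hy1)) (invYX_mem hU))))

theorem obstruction_mem (α β γ δ : 𝕜) : obstruction hU α β γ δ ∈ coordAlgebra hU :=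
  sub_mem (sub_mem (derX_mem_coordAlgebra hU (derX_mem_coordAlgebra hU (smoothA_mem hU)))
    (mul_mem (smoothB_mem hU) (derX_mem_coordAlgebra hU (smoothA_mem hU))))
    (derY_mem_coordAlgebra hU (sub_mem (derY_mem_coordAlgebra hU (smoothC_mem hU α β γ δ))
      (mul_mem (smoothA_mem hU) (smoothC_mem hU α β γ δ))))

theorem params_of_obstruction_eq_zero {α β γ δ x : 𝕜} {s : Set 𝕜} (hs : ∀ y ∈ s, (x, y) ∈ U)
    (hinf : s.Infinite) (h : ∀ y (hy : y ∈ s), obstruction hU α β γ δ ⟨(x, y), hs y hy⟩ = 0) :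
    α = 0 ∧ β = 0 ∧ γ = 0 ∧ δ = 1 / 2 := by
  obtain ⟨y₁, hy₁⟩ := hinf.nonempty
  have hx0 : x ≠ 0 := (hU (hs y₁ hy₁)).1
  have hx1 : x - 1 ≠ 0 := sub_ne_zero.2 (hU (hs y₁ hy₁)).2.1
  -- G is W multiplied by x²(x-1)²P³, as a polynomial in y. Its values at 0, 1 and x isolate β, γ
  -- and 1/2 - δ respectively.
  let G : 𝕜[X] := C ((1 / 2 - δ) * (3 * x ^ 2 * (x - 1) ^ 2)) * (X ^ 3 * (X - 1) ^ 3) +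
    C ((1 / 2 - δ) * (2 * x - 1) * x * (x - 1)) * (X ^ 3 * (X - 1) ^ 3 * (X - C x)) -
    (C α * ((3 * X - 1 - C x) * X ^ 3 * (X - 1) ^ 3 * (X - C x) ^ 3) +
      C (β * x) * ((3 * C x - (1 + C x) * X) * (X - 1) ^ 3 * (X - C x) ^ 3) +
      C (γ * (x - 1)) * ((C (2 - x) * (X - 1) - 3 * C (x - 1)) * X ^ 3 * (X - C x) ^ 3))
  have hG : G = 0 := by
    refine eq_zero_of_infinite_isRoot G (hinf.mono fun y hy => ?_)
    have hy0 : y ≠ 0 := (hU (hs y hy)).2.2.1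
    have hy1 : y - 1 ≠ 0 := sub_ne_zero.2 (hU (hs y hy)).2.2.2.1
    have hyx : y - x ≠ 0 := sub_ne_zero.2 (hU (hs y hy)).2.2.2.2
    have h0 := h y hy
    rw [obstruction_apply] at h0
    have : G.eval y = (x ^ 2 * (x - 1) ^ 2 * (y ^ 3 * (y - 1) ^ 3 * (y - x) ^ 3)) *
        ((1 / 2 - δ) * (3 / (y - x) ^ 3 + (2 * x - 1) / (x * (x - 1)) / (y - x) ^ 2) -
      (α * (3 * y - 1 - x) + β * x * (3 * x / y ^ 3 - (1 + x) / y ^ 2) +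
        γ * (x - 1) * ((2 - x) / (y - 1) ^ 2 - 3 * (x - 1) / (y - 1) ^ 3)) /
          (x ^ 2 * (x - 1) ^ 2)) := by
      simp [G]
      field_simp
    rw [Set.mem_ofPred_eq, IsRoot, this, h0, mul_zero]
  have hβ : β = 0 := by
    have := congrArg (eval 0) hG
    simpa [G, hx0] using this
  have hγ : γ = 0 := by
    have := congrArg (eval 1) hG
    simpa [G, hx1, sub_eq_zero, (sub_ne_zero.1 hx1).symm, sub_ne_zero.1 hx1] using this
  have hδ : δ = 1 / 2 := by
    have := congrArg (eval x) hG
    simp [G, hx0, hx1, hβ, hγ] at this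
    linear_combination -this
  -- Only α(3y - 1 - x) remains, and a nonzero α would force the same y at any two points of s.
  obtain ⟨y₂, hy₂, hne⟩ := hinf.exists_notMem_finite (Set.finite_singleton y₁)
  have h1 := h y₁ hy₁
  have h2 := h y₂ hy₂
  rw [obstruction_apply] at h1 h2
  simp only [hβ, hγ, hδ] at h1 h2
  have hK : x ^ 2 * (x - 1) ^ 2 ≠ 0 := by simp [hx0, hx1]
  simp [hx0, hx1] at h1 h2
  refine ⟨?_, hβ, hγ, hδ⟩
  by_contra hα
  refine hne ?_
  simp [hα] at h1 h2
  have : (3 : 𝕜) * (y₂ - y₁) = 0 := by linear_combination h2 - h1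
  simpa [sub_eq_zero] using this

end PainleveVI

/-! ### Absence of symmetries for all other parameters. -/

namespace PainleveVI

open PointSymmetry TopologicalSpace smoothAlgebra Polynomial

variable {𝕜 : Type*} [RCLike 𝕜] {U : Opens (𝕜 × 𝕜)}

/-- Thus a is the logarithmic y-derivative of √P, which brings in the rational solutions studied
above. -/
theorem two_mul_branchPoly_mul_coeffA {x y : 𝕜} (h : (x, y) ∈ regularSet 𝕜) :
    2 * (branchPoly x).eval y * coeffA (x, y) = (derivative (branchPoly x)).eval y := by
  obtain ⟨h0, h1, h2, h3, h4⟩ := h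
  have h2 : y ≠ 0 := h2
  have h3 : y - 1 ≠ 0 := sub_ne_zero.2 h3
  have h4 : y - x ≠ 0 := sub_ne_zero.2 h4
  rw [eval_branchPoly, eval_derivative_branchPoly]
  simp only [coeffA]
  field_simp

variable (hU : (U : Set (𝕜 × 𝕜)) ⊆ regularSet 𝕜)

/-- Along the vertical line φ is rational, because 2Wφ is and W is not identically zero there. It
also solves a linear equation in y whose rational solutions are controlled by `eq_zero_of_rational`.
-/
theorem eq_zero_of_determining {α β γ δ : 𝕜} {ξ φ : smoothAlgebra U} {x : 𝕜} {s : Set 𝕜}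
    (hso : IsOpen s) (hsc : IsPreconnected s) (hinf : s.Infinite) (hs : ∀ y ∈ s, (x, y) ∈ U)
    (hne : ¬(α = 0 ∧ β = 0 ∧ γ = 0 ∧ δ = 1 / 2))
    (h : DeterminingEquations (derX U) (derY U) (smoothA hU) (smoothB hU) (smoothC hU α β γ δ)
      ξ φ) (hξ : derY U ξ = 0) {y : 𝕜} (hy : y ∈ s) :
    ξ ⟨(x, y), hs y hy⟩ = 0 ∧ φ ⟨(x, y), hs y hy⟩ = 0 := by
  have hcomm := der_comm (U := U) (0, 1) (1, 0)
  obtain ⟨V, n, hV⟩ := coordAlgebra_le_rationalAt hU x s hs (obstruction_mem hU α β γ δ)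
  have hreg : ∀ w ∈ s, (x, w) ∈ regularSet 𝕜 := fun w hw => hU (hs w hw)
  have hPne : ∀ w ∈ s, (branchPoly x).eval w ≠ 0 := fun w hw => by
    obtain ⟨-, -, h2, h3, h4⟩ := hreg w hw
    rw [eval_branchPoly]
    exact mul_ne_zero (mul_ne_zero h2 (sub_ne_zero.2 h3)) (sub_ne_zero.2 h4)
  have hV0 : V ≠ 0 := by
    rintro rfl
    refine hne (params_of_obstruction_eq_zero hU hs hinf fun w hw => ?_)
    exact (mul_eq_zero.1 ((hV w hw).trans eval_zero)).resolve_right (pow_ne_zero _ (hPne w hw))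
  have hP0 : branchPoly x ≠ 0 := fun h0 => hPne y hy (by rw [h0, eval_zero])
  have mem : ∀ {f : smoothAlgebra U}, f ∈ coordAlgebra hU → f ∈ rationalAt x s hs :=
    fun hf => coordAlgebra_le_rationalAt hU x s hs hf
  have memξ : ∀ {f : smoothAlgebra U}, derY U f = 0 → f ∈ rationalAt x s hs := fun {f} hf => by
    obtain ⟨c, hc⟩ := eq_of_derY_eq_zero (f := f) hso hsc hs (fun w hw => by rw [hf]; rfl)
    exact mem_rationalAt_of_const hc
  have hξ1 : derY U (derX U ξ) = 0 := by rw [hcomm, hξ, map_zero]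
  have hξ2 : derY U (derX U (derX U ξ)) = 0 := by rw [hcomm, hξ1, map_zero]
  have hξ3 : derY U (derX U (derX U (derX U ξ))) = 0 := by rw [hcomm, hξ2, map_zero]
  have hA := smoothA_mem hU
  have hB := smoothB_mem hU
  have hC := smoothC_mem hU α β γ δ
  have dX := fun {f} (hf : f ∈ coordAlgebra hU) => derX_mem_coordAlgebra hU hf
  have dY := fun {f} (hf : f ∈ coordAlgebra hU) => derY_mem_coordAlgebra hU hf
  have two : (2 : smoothAlgebra U) ∈ rationalAt x s hs := ofNat_mem _ 2
  have four : (4 : smoothAlgebra U) ∈ rationalAt x s hs := ofNat_mem _ 4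
  have key := h.obstruction_mul_snd hcomm (derY_smoothB hU) hξ
  -- By `obstruction_mul_snd`, 2Wφ is a combination of ξ and its x-derivatives, which are constant
  -- along the line, with elements of `coordAlgebra`.
  obtain ⟨R, m, hR⟩ : 2 * obstruction hU α β γ δ * φ ∈ rationalAt x s hs := by
    rw [obstruction, key]
    refine neg_mem (sub_mem (sub_mem (add_mem (sub_mem (add_mem (add_mem (add_mem (memξ hξ3)
      (mul_mem (memξ hξ) (mem (dX (dX hB))))) (mul_mem (mul_mem two (mem (dX hB))) (memξ hξ1)))
      (mul_mem (mem hB) (memξ hξ2))) (mul_mem (mem hB) (add_mem (add_mem (memξ hξ2)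
      (mul_mem (memξ hξ) (mem (dX hB)))) (mul_mem (mem hB) (memξ hξ1)))))
      (mul_mem (mul_mem (mul_mem two (mem hC)) (memξ hξ)) (mem (dX hA))))
      (mul_mem (mul_mem four (memξ hξ1)) (mem (sub_mem (dY hC) (mul_mem hA hC)))))
      (mul_mem (mul_mem two (memξ hξ)) (mem (sub_mem (dX (dY hC)) (mul_mem hA (dX hC))))))
  -- Since a_x = 1/(2(y-x)²) is the y-derivative of -1/(2(y-x)), `snd_deriv` integrates in y.
  obtain ⟨c, hc⟩ := eq_of_derY_eq_zero (x := x)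
    (f := derY U φ - smoothA hU * φ + algebraMap 𝕜 _ (1 / 2) * ξ * invYX hU) hso hsc hs
    (fun w hw => by
      have h1 := h.snd_deriv hξ
      have h2 : derY U (derY U φ - smoothA hU * φ + algebraMap 𝕜 _ (1 / 2) * ξ * invYX hU) = 0 := by
        rw [map_add, h1, derX_smoothA]
        simp only [Derivation.leibniz, Derivation.map_algebraMap, hξ, derY_invYX, smul_eq_mul]
        ring
      rw [h2]
      rfl)
  obtain ⟨σ, hσ⟩ := eq_of_derY_eq_zero (f := ξ) hso hsc hs (fun w hw => by rw [hξ]; rfl)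
  -- φ = M/N on the line; the identity is kept in the form φN = M because N may have zeros in s.
  set N : 𝕜[X] := 2 * V * branchPoly x ^ m with hNdef
  set M : 𝕜[X] := R * branchPoly x ^ n with hMdef
  have hN0 : N ≠ 0 := mul_ne_zero (mul_ne_zero two_ne_zero hV0) (pow_ne_zero _ hP0)
  have hMN : ∀ w (hw : w ∈ s), φ ⟨(x, w), hs w hw⟩ * N.eval w = M.eval w := fun w hw => by
    have h1 := hV w hw
    have h2 := hR w hw
    simp only [Subalgebra.coe_mul, Pi.mul_apply, ofNat_apply] at h2
    simp only [hNdef, hMdef, eval_mul, eval_pow, ← h1, ← h2, eval_ofNat]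
    ring
  have hMN' : ∀ w (hw : w ∈ s), derY U φ ⟨(x, w), hs w hw⟩ * N.eval w +
      φ ⟨(x, w), hs w hw⟩ * (derivative N).eval w = (derivative M).eval w := fun w hw => by
    have h1 := (hasDerivAt_rep_snd φ (hs w hw)).mul (N.hasDerivAt w)
    have h2 : (fun w => rep φ (x, w)) * (fun w => N.eval w) =ᶠ[nhds w] fun w => M.eval w := by
      filter_upwards [hso.mem_nhds hw] with v hv
      rw [Pi.mul_apply, ← hMN v hv, ← rep_apply φ ⟨(x, v), hs v hv⟩]
    have h3 := (h2.hasDerivAt_iff.1 h1).unique (M.hasDerivAt w)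
    rw [← h3, rep_apply φ ⟨(x, w), hs w hw⟩]
  -- This is 2P φ' = P' φ + 2cP - σ y(y-1) with denominators cleared. It holds on the infinite set
  -- s, hence as an identity of polynomials.
  have hpoly : 2 * branchPoly x * (derivative M * N - M * derivative N) =
      derivative (branchPoly x) * M * N +
        N ^ 2 * (2 * C c * branchPoly x - C σ * (X * (X - 1))) := by
    refine eq_of_infinite_eval_eq _ _ (hinf.mono fun w hw => ?_)
    have h1 := hc w hw
    have hA := two_mul_branchPoly_mul_coeffA (hreg w hw)
    have hyx : w - x ≠ 0 := sub_ne_zero.2 (hreg w hw).2.2.2.2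
    have hk : (w - x)⁻¹ * (branchPoly x).eval w = w * (w - 1) := by
      rw [eval_branchPoly]; field_simp
    simp only [Subalgebra.coe_add, Pi.add_apply, Subalgebra.coe_sub, Pi.sub_apply,
      Subalgebra.coe_mul, Pi.mul_apply, smoothA_apply, invYX_apply, hσ w hw,
      algebraMap_apply'] at h1
    rw [Set.mem_ofPred_eq]
    simp only [eval_mul, eval_sub, eval_add, eval_pow, eval_C, eval_X, eval_one, eval_ofNat,
      ← hMN w hw, ← hMN' w hw, ← hA]
    linear_combination (2 * (branchPoly x).eval w * N.eval w ^ 2) * h1 -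
      N.eval w ^ 2 * σ * hk
  have hreg' := hreg y hy
  obtain ⟨hM, hσ0⟩ := eq_zero_of_rational hreg'.1 hreg'.2.1 hN0 hpoly
  refine ⟨(hσ y hy).trans hσ0, ?_⟩
  exact eq_zero_of_mul_eval_eq_zero hso hs hN0 (fun w hw => by rw [hMN w hw, hM, eval_zero]) hy

theorem satisfiesDetermining_equation_iff {α β γ δ : 𝕜} {F : 𝕜 × 𝕜 → 𝕜 × 𝕜}
    (hF : ContDiffOn 𝕜 ∞ F U) :
    SatisfiesDetermining (equation α β γ δ) U F ↔
      DeterminingEquations (derX U) (derY U) (smoothA hU) (smoothB hU) (smoothC hU α β γ δ)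
        (mk (fun z => (F z).1) hF.fst) (mk (fun z => (F z).2) hF.snd) := by
  have key : ∀ (f : smoothAlgebra U) (g : 𝕜 × 𝕜 → 𝕜), (∀ z, f z = g z) →
      ∃ hg : ContDiffOn 𝕜 ∞ g U, mk g hg = f := fun f g h =>
    ⟨(contDiffOn_rep f).congr fun z hz => by rw [rep_apply f ⟨z, hz⟩, h],
      ext fun z => by rw [mk_apply, h]⟩
  obtain ⟨hA, eA⟩ := key (smoothA hU) coeffA (smoothA_apply hU)
  obtain ⟨hB, eB⟩ := key (smoothB hU) coeffB (smoothB_apply hU)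
  obtain ⟨hC, eC⟩ := key (smoothC hU α β γ δ) (coeffC α β γ δ) (smoothC_apply hU α β γ δ)
  rw [equation_eq_quadraticODE, satisfiesDetermining_quadraticODE_iff hA hB hC hF, eA, eB, eC]

theorem exists_fiber {x y : 𝕜} (h : (x, y) ∈ U) :
    ∃ s : Set 𝕜, IsOpen s ∧ IsPreconnected s ∧ s.Infinite ∧ y ∈ s ∧ ∀ w ∈ s, (x, w) ∈ U := by
  have hc : Continuous fun w : 𝕜 => (x, w) := by fun_prop
  obtain ⟨ε, hε, hs⟩ := Metric.isOpen_iff.1 (U.isOpen.preimage hc) y h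
  exact ⟨Metric.ball y ε, Metric.isOpen_ball, (convex_ball y ε).isPreconnected,
    infinite_of_mem_nhds y (Metric.ball_mem_nhds y hε), Metric.mem_ball_self hε, fun w hw => hs hw⟩

/-- The argument is made separately on a small piece of the vertical line through each point, so U
need not be connected. -/
theorem params_of_symmetryAlgebra_ne_bot {α β γ δ : 𝕜} {U : Set (𝕜 × 𝕜)} (hUo : IsOpen U)
    (hU : U ⊆ regularSet 𝕜) (h : symmetryAlgebra (equation α β γ δ) U hUo ≠ ⊥) :
    α = 0 ∧ β = 0 ∧ γ = 0 ∧ δ = 1 / 2 := by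
  by_contra hne
  refine h ((Submodule.eq_bot_iff _).2 ?_)
  rintro F ⟨hF, hF0, hFs⟩
  let W : Opens (𝕜 × 𝕜) := ⟨U, hUo⟩
  have hW : (W : Set (𝕜 × 𝕜)) ⊆ regularSet 𝕜 := hU
  have hFW : ContDiffOn 𝕜 ∞ F W := hF
  have hdet := (satisfiesDetermining_equation_iff hW hFW).1 hFs
  have hcomm := der_comm (U := W) (0, 1) (1, 0)
  have hξ : derY W (mk (fun z => (F z).1) hFW.fst) = 0 := by
    ext ⟨⟨x, y⟩, hz⟩
    obtain ⟨s, hso, hsc, hinf, hys, hs⟩ := exists_fiber hz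
    obtain ⟨V, n, hV⟩ := coordAlgebra_le_rationalAt hW x s hs (obstruction_mem hW α β γ δ)
    have hV0 : V ≠ 0 := by
      rintro rfl
      refine hne (params_of_obstruction_eq_zero hW hs hinf fun w hw => ?_)
      obtain ⟨-, -, h2, h3, h4⟩ := hW (hs w hw)
      refine (mul_eq_zero.1 ((hV w hw).trans eval_zero)).resolve_right (pow_ne_zero _ ?_)
      rw [eval_branchPoly]
      exact mul_ne_zero (mul_ne_zero h2 (sub_ne_zero.2 h3)) (sub_ne_zero.2 h4)
    refine eq_zero_of_mul_eval_eq_zero hso hs hV0 (fun w hw => ?_) hys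
    have h3 := congrFun (congrArg Subtype.val (hdet.obstruction_mul hcomm (derY_smoothB hW)))
      ⟨(x, w), hs w hw⟩
    rw [← obstruction] at h3
    simp only [Subalgebra.coe_mul, Pi.mul_apply, ofNat_apply, ZeroMemClass.coe_zero,
      Pi.zero_apply] at h3
    rw [← hV w hw]
    linear_combination (1 / 3 * (branchPoly x).eval w ^ n) * h3
  ext1 ⟨x, y⟩
  by_cases hz : (x, y) ∈ U
  · obtain ⟨s, hso, hsc, hinf, hys, hs⟩ := exists_fiber (U := W) hz
    obtain ⟨h1, h2⟩ := eq_zero_of_determining hW hso hsc hinf hs hne hdet hξ hys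
    exact Prod.ext h1 h2
  · exact hF0 _ hz

end PainleveVI

/-! ### Flat coordinates and the transformation of the determining equations. -/

namespace PointSymmetry

/-- Coordinates `t = t(x)`, `v = v(x, y)` that carry the equation `y'' = a y'² + b y' + c` to
`d²v/dt² = 0`, described through `τ = t'`, `σ = v_y`, their inverses `ρ` and `κ`, and
`θ = v_x / v_y`, `l = τ' / τ`, `m = v_xy / v_y`. -/
structure FlatCoordinates {k A : Type*} [Field k] [CommRing A] [Algebra k A]
    (D E : Derivation k A A) (a b c t v τ ρ σ κ θ l m : A) : Prop where
  comm : ∀ f, E (D f) = D (E f)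
  tx : D t = τ
  ty : E t = 0
  vx : D v = θ * σ
  vy : E v = σ
  τρ : τ * ρ = 1
  σκ : σ * κ = 1
  τx : D τ = τ * l
  σx : D σ = σ * m
  σy : E σ = -(a * σ)
  b_eq : b = l - 2 * m
  θx : D θ = (l - m) * θ - c

namespace FlatCoordinates

variable {k A : Type*} [Field k] [CommRing A] [Algebra k A] {D E : Derivation k A A}
  {a b c t v τ ρ σ κ θ l m ξ φ : A}

theorem τy (h : FlatCoordinates D E a b c t v τ ρ σ κ θ l m) : E τ = 0 := by
  rw [← h.tx, h.comm, h.ty, map_zero]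

theorem l_eq (h : FlatCoordinates D E a b c t v τ ρ σ κ θ l m) : l = ρ * D τ := by
  rw [h.τx]; linear_combination (-l) * h.τρ

theorem ρy (h : FlatCoordinates D E a b c t v τ ρ σ κ θ l m) : E ρ = 0 := by
  rw [E.leibniz_of_mul_eq_one (by rw [mul_comm, h.τρ]), h.τy, smul_zero]

theorem ρx (h : FlatCoordinates D E a b c t v τ ρ σ κ θ l m) : D ρ = -(ρ * l) := by
  rw [D.leibniz_of_mul_eq_one (b := τ) (by rw [mul_comm, h.τρ]), h.τx, smul_eq_mul]
  linear_combination (-ρ * l) * h.τρ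

theorem κy (h : FlatCoordinates D E a b c t v τ ρ σ κ θ l m) : E κ = a * κ := by
  rw [E.leibniz_of_mul_eq_one (b := σ) (by rw [mul_comm, h.σκ]), h.σy, smul_eq_mul]
  linear_combination (a * κ) * h.σκ

theorem κx (h : FlatCoordinates D E a b c t v τ ρ σ κ θ l m) : D κ = -(κ * m) := by
  rw [D.leibniz_of_mul_eq_one (b := σ) (by rw [mul_comm, h.σκ]), h.σx, smul_eq_mul]
  linear_combination (-κ * m) * h.σκ

theorem ly (h : FlatCoordinates D E a b c t v τ ρ σ κ θ l m) : E l = 0 := by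
  rw [h.l_eq, E.leibniz, h.ρy, h.comm, h.τy]; simp

/-- The equality of the mixed derivatives of v gives θ_y; those of σ and θ give m_y and m_x below.
With these formulas every derivative of the structure functions can be eliminated. -/
theorem θy (h : FlatCoordinates D E a b c t v τ ρ σ κ θ l m) : E θ = m + a * θ := by
  have h1 := congrArg E h.vx
  rw [h.comm, h.vy, E.leibniz, h.σx, h.σy, smul_eq_mul, smul_eq_mul] at h1
  linear_combination (-κ) * h1 - (E θ - m - a * θ) * h.σκ

theorem my (h : FlatCoordinates D E a b c t v τ ρ σ κ θ l m) : E m = -D a := by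
  have h1 := h.comm σ
  rw [h.σx, h.σy] at h1
  simp only [map_neg, Derivation.leibniz, smul_eq_mul, h.σx, h.σy] at h1
  linear_combination κ * h1 - (E m + D a) * h.σκ

theorem mx (h : FlatCoordinates D E a b c t v τ ρ σ κ θ l m) :
    D m = l * m - m ^ 2 - E c + a * c := by
  have h1 := h.comm θ
  rw [h.θx, h.θy] at h1
  simp only [map_add, map_sub, Derivation.leibniz, smul_eq_mul, h.θx, h.θy, h.ly, h.my] at h1
  linear_combination -h1

/-- The derivation `∂_v` in the coordinates `t`, `v`. -/
def derV (E : Derivation k A A) (κ : A) : Derivation k A A := κ • E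

/-- The derivation `∂_t` in the coordinates `t`, `v`. -/
def derT (D E : Derivation k A A) (ρ θ : A) : Derivation k A A := ρ • (D - θ • E)

theorem derV_apply (f : A) : derV E κ f = κ * E f := rfl

theorem derT_apply (f : A) : derT D E ρ θ f = ρ * (D f - θ * E f) := rfl

theorem der_comm (h : FlatCoordinates D E a b c t v τ ρ σ κ θ l m) (f : A) :
    derV E κ (derT D E ρ θ f) = derT D E ρ θ (derV E κ f) := by
  simp only [derV_apply, derT_apply, Derivation.leibniz, map_sub, smul_eq_mul, h.ρy, h.θy, h.κx,
    h.κy, h.comm]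
  ring

theorem derT_t (h : FlatCoordinates D E a b c t v τ ρ σ κ θ l m) : derT D E ρ θ t = 1 := by
  rw [derT_apply, h.tx, h.ty]; linear_combination h.τρ

theorem derV_t (h : FlatCoordinates D E a b c t v τ ρ σ κ θ l m) : derV E κ t = 0 := by
  rw [derV_apply, h.ty, mul_zero]

theorem derT_v (h : FlatCoordinates D E a b c t v τ ρ σ κ θ l m) : derT D E ρ θ v = 0 := by
  rw [derT_apply, h.vx, h.vy]; ring

theorem derV_v (h : FlatCoordinates D E a b c t v τ ρ σ κ θ l m) : derV E κ v = 1 := by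
  rw [derV_apply, h.vy, mul_comm, h.σκ]

theorem derT_eq_zero_iff (h : FlatCoordinates D E a b c t v τ ρ σ κ θ l m) {f : A}
    (hT : derT D E ρ θ f = 0) (hV : derV E κ f = 0) : D f = 0 ∧ E f = 0 := by
  rw [derV_apply] at hV
  rw [derT_apply] at hT
  have hE : E f = 0 := by linear_combination σ * hV - E f * h.σκ
  refine ⟨?_, hE⟩
  rw [hE] at hT
  linear_combination τ * hT - D f * h.τρ

/-- The determining equations of the point symmetries `T ∂_t + S ∂_v` of `d²v/dt² = 0`. -/
structure FlatEquations (Dt Dv : Derivation k A A) (T S : A) : Prop where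
  cubic : Dv (Dv T) = 0
  quadratic : Dv (Dv S) = 2 * Dt (Dv T)
  linear : 2 * Dt (Dv S) = Dt (Dt T)
  constant : Dt (Dt S) = 0

/-- τξ = X(t) and σ(θξ + φ) = X(v) are the components of X in the flat coordinates. Since dv/dt =
ρσ(p + θ), the flat equations are the coefficients of the cubic polynomial e0 + e1 p + e2 p² - e3 p³
re-expanded at p = -θ, up to units. The passage is thus triangular and invertible. -/
theorem determiningEquations_iff (h : FlatCoordinates D E a b c t v τ ρ σ κ θ l m) :
    DeterminingEquations D E a b c ξ φ ↔
      FlatEquations (derT D E ρ θ) (derV E κ) (τ * ξ) (σ * (θ * ξ + φ)) := by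
  have two (D : Derivation k A A) : D (2 : A) = 0 := by exact_mod_cast D.map_natCast 2
  have hTv : derV E κ (τ * ξ) = κ * τ * E ξ := by
    simp only [derV_apply, Derivation.leibniz, smul_eq_mul, h.τy]; ring
  have hTt : derT D E ρ θ (τ * ξ) = l * ξ + D ξ - θ * E ξ := by
    simp only [derT_apply, Derivation.leibniz, smul_eq_mul, h.τy, h.τx]
    linear_combination (l * ξ + D ξ - θ * E ξ) * h.τρ
  set η := θ * ξ + φ with hη
  have hSv : derV E κ (σ * η) = E η - a * η := by
    simp only [derV_apply, Derivation.leibniz, smul_eq_mul, h.σy]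
    linear_combination (E η - a * η) * h.σκ
  have hSt : derT D E ρ θ (σ * η) = ρ * σ * (D η + m * η - θ * (E η - a * η)) := by
    simp only [derT_apply, Derivation.leibniz, smul_eq_mul, h.σy, h.σx]
    ring
  set e3 := E (E ξ) + a * E ξ with he3
  set e2 := E (E φ) - 2 * D (E ξ) - a * E φ - 2 * b * E ξ - (ξ * D a + φ * E a) with he2
  set e1 := 2 * D (E φ) - D (D ξ) - b * D ξ - 3 * c * E ξ - 2 * a * D φ - (ξ * D b + φ * E b)
    with he1
  set e0 := D (D φ) + (E φ - 2 * D ξ) * c - b * D φ - (ξ * D c + φ * E c) with he0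
  have f3 : derV E κ (derV E κ (τ * ξ)) = κ ^ 2 * τ * e3 := by
    rw [hTv, derV_apply]
    simp only [Derivation.leibniz, smul_eq_mul, h.τy, h.κy, he3]
    ring
  have f2 : derV E κ (derV E κ (σ * η)) - 2 * derT D E ρ θ (derV E κ (τ * ξ)) =
      κ * (e2 + 3 * θ * e3) := by
    rw [hSv, ← h.der_comm, hTt]
    simp only [derV_apply, map_add, map_sub, Derivation.leibniz, smul_eq_mul, h.ly, h.θy, h.my,
      hη, he2, he3, h.b_eq, h.comm]
    ring
  have f1 : 2 * derT D E ρ θ (derV E κ (σ * η)) - derT D E ρ θ (derT D E ρ θ (τ * ξ)) =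
      ρ * (e1 - 2 * θ * e2 - 3 * θ ^ 2 * e3) := by
    rw [hSv, hTt]
    simp only [derT_apply, map_add, map_sub, Derivation.leibniz, smul_eq_mul, h.ly, h.θy, h.θx,
      h.my, h.mx, hη, he1, he2, he3, h.b_eq, h.comm, two]
    ring
  have f0 : derT D E ρ θ (derT D E ρ θ (σ * η)) =
      ρ ^ 2 * σ * (e0 - θ * e1 + θ ^ 2 * e2 + θ ^ 3 * e3) := by
    rw [hSt]
    simp only [derT_apply, map_add, map_sub, Derivation.leibniz, smul_eq_mul, h.ly, h.θy, h.θx,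
      h.ρx, h.ρy, h.σx, h.σy, h.my, h.mx, hη, he0, he1, he2, he3, h.b_eq, h.comm, two]
    ring
  constructor
  · rintro ⟨g3, g2, g1, g0⟩
    have g3 : e3 = 0 := g3
    have g2 : e2 = 0 := sub_eq_zero.2 g2
    have g1 : e1 = 0 := sub_eq_zero.2 g1
    have g0 : e0 = 0 := sub_eq_zero.2 g0
    refine ⟨?_, sub_eq_zero.1 ?_, sub_eq_zero.1 ?_, ?_⟩
    · rw [f3, g3, mul_zero]
    · rw [f2, g2, g3]; ring
    · rw [f1, g1, g2, g3]; ring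
    · rw [f0, g0, g1, g2, g3]; ring
  · rintro ⟨g3, g2, g1, g0⟩
    rw [f3] at g3
    rw [← sub_eq_zero, f2] at g2
    rw [← sub_eq_zero, f1] at g1
    rw [f0] at g0
    have hκ : IsUnit κ := IsUnit.of_mul_eq_one σ (by rw [mul_comm, h.σκ])
    have hσ : IsUnit σ := IsUnit.of_mul_eq_one κ h.σκ
    have hρ : IsUnit ρ := IsUnit.of_mul_eq_one τ (by rw [mul_comm, h.τρ])
    have hτ : IsUnit τ := IsUnit.of_mul_eq_one ρ h.τρ
    have g3 : e3 = 0 := (((hκ.pow 2).mul hτ).mul_right_eq_zero).1 g3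
    have g2 : e2 = 0 := by
      have := hκ.mul_right_eq_zero.1 g2
      rwa [g3, mul_zero, add_zero] at this
    have g1 : e1 = 0 := by
      have := hρ.mul_right_eq_zero.1 g1
      rwa [g3, g2, mul_zero, mul_zero, sub_zero, sub_zero] at this
    have g0 : e0 = 0 := by
      have := ((hρ.pow 2).mul hσ).mul_right_eq_zero.1 g0
      rwa [g3, g2, g1, mul_zero, mul_zero, mul_zero, sub_zero, add_zero, add_zero] at this
    exact ⟨g3, sub_eq_zero.1 g2, sub_eq_zero.1 g1, sub_eq_zero.1 g0⟩

end FlatCoordinates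

end PointSymmetry

/-! ### The point symmetries of d²v/dt² = 0. -/

namespace PointSymmetry

namespace FlatCoordinates

section Solution

variable {k A : Type*} [Field k] [CommRing A] [Algebra k A] {Dt Dv : Derivation k A A}
  {t v T S : A}

/-- The first component of the general point symmetry of `d²v/dt² = 0`. -/
def flatFst (t v : A) (c : Fin 8 → k) : A :=
  algebraMap k A (c 0) + algebraMap k A (c 1) * t + algebraMap k A (c 2) * v +
    algebraMap k A (c 3) * t ^ 2 + algebraMap k A (c 4) * (t * v)

/-- The second component of the general point symmetry of `d²v/dt² = 0`. -/
def flatSnd (t v : A) (c : Fin 8 → k) : A :=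
  algebraMap k A (c 5) + algebraMap k A (c 6) * t + algebraMap k A (c 7) * v +
    algebraMap k A (c 3) * (t * v) + algebraMap k A (c 4) * v ^ 2

theorem flatEquations_flat (htt : Dt t = 1) (hvt : Dv t = 0) (htv : Dt v = 0) (hvv : Dv v = 1)
    (c : Fin 8 → k) : FlatEquations Dt Dv (flatFst t v c) (flatSnd t v c) := by
  constructor <;>
  simp only [flatFst, flatSnd, map_add, Derivation.leibniz, Derivation.leibniz_pow,
    Derivation.map_algebraMap, htt, hvt, htv, hvv, smul_eq_mul, mul_zero, mul_one, add_zero,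
    zero_add, pow_one, nsmul_eq_mul, smul_zero, Nat.add_one_sub_one, Derivation.map_natCast] <;> push_cast <;> ring

/-- All third derivatives of T vanish, so T is a quadratic polynomial in t, v; the equations then
fix the second derivatives of S. The eight constants are those of the successive integrations. -/
theorem FlatEquations.exists_eq_flat [CharZero k] (hcomm : ∀ f, Dv (Dt f) = Dt (Dv f))
    (hconst : ∀ f, Dt f = 0 → Dv f = 0 → ∃ c : k, f = algebraMap k A c)
    (htt : Dt t = 1) (hvt : Dv t = 0) (htv : Dt v = 0) (hvv : Dv v = 1)
    (h : FlatEquations Dt Dv T S) : ∃ c : Fin 8 → k, T = flatFst t v c ∧ S = flatSnd t v c := by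
  obtain ⟨h3, h2, h1, h0⟩ := h
  have two (D : Derivation k A A) : D (2 : A) = 0 := by exact_mod_cast D.map_natCast 2
  have e2 : algebraMap k A 2 = 2 := map_ofNat _ 2
  have cancel : ∀ {n : k} (_ : n ≠ 0) {f : A}, algebraMap k A n * f = 0 → f = 0 := by
    intro n hn f hf
    rw [← one_mul f, ← map_one (algebraMap k A), ← inv_mul_cancel₀ hn, map_mul, mul_assoc, hf,
      mul_zero]
  -- `linear` and `quadratic` give two values of S_tvv, hence 3T_ttv = 0; `linear` and `constant`
  -- give T_ttt = 2S_ttv = 0.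
  have h2v := congrArg Dv h2
  have h2t := congrArg Dt h2
  have h1v := congrArg Dv h1
  have h1t := congrArg Dt h1
  have h3t := congrArg Dt h3
  have h0v := congrArg Dv h0
  simp only [Derivation.leibniz, two, smul_eq_mul, mul_zero, add_zero, hcomm, map_zero]
    at h2v h2t h1v h1t h3t h0v
  have hTtvv : Dt (Dv (Dv T)) = 0 := h3t
  have hTttv : Dt (Dt (Dv T)) = 0 := cancel (n := 3) three_ne_zero (by
    rw [map_ofNat]; linear_combination h1v - 2 * h2t)
  have hTttt : Dt (Dt (Dt T)) = 0 := by linear_combination 2 * h0v - h1t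
  obtain ⟨c4, hc4⟩ := hconst (Dt (Dv T)) hTttv (by rw [hcomm, h3, map_zero])
  obtain ⟨d, hd⟩ := hconst (Dt (Dt T)) hTttt (by rw [hcomm, hcomm, hTttv])
  set c3 := d / 2 with hc3
  have hd3 : algebraMap k A d = 2 * algebraMap k A c3 := by
    rw [← e2, ← map_mul, hc3]; congr 1; field_simp
  have hStv : Dt (Dv S) = algebraMap k A c3 := by
    refine sub_eq_zero.1 (cancel (n := 2) two_ne_zero ?_)
    rw [e2, mul_sub, h1, hd, hd3, sub_self]
  have hSvv : Dv (Dv S) = 2 * algebraMap k A c4 := by rw [h2, hc4]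
  obtain ⟨c2, hc2⟩ := hconst (Dv T - algebraMap k A c4 * t)
    (by simp [htt, hc4]) (by simp [hvt, h3])
  obtain ⟨c1, hc1⟩ := hconst (Dt T - 2 * algebraMap k A c3 * t - algebraMap k A c4 * v)
    (by simp [htt, htv, hd, hd3, two])
    (by simp [hvt, hvv, hcomm, hc4, two])
  obtain ⟨c7, hc7⟩ := hconst (Dv S - 2 * algebraMap k A c4 * v - algebraMap k A c3 * t)
    (by simp [htt, htv, hStv, two]) (by simp [hvt, hvv, hSvv, two])
  obtain ⟨c6, hc6⟩ := hconst (Dt S - algebraMap k A c3 * v)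
    (by simp [htv, h0]) (by simp [hvv, hcomm, hStv])
  obtain ⟨c0, hc0⟩ := hconst (T - (algebraMap k A c1 * t + algebraMap k A c2 * v +
      algebraMap k A c3 * t ^ 2 + algebraMap k A c4 * (t * v)))
    (by
      simp [htt, htv, Derivation.leibniz_pow]
      linear_combination hc1)
    (by
      simp [hvt, hvv, Derivation.leibniz_pow]
      linear_combination hc2)
  obtain ⟨c5, hc5⟩ := hconst (S - (algebraMap k A c6 * t + algebraMap k A c7 * v +
      algebraMap k A c3 * (t * v) + algebraMap k A c4 * v ^ 2))
    (by
      simp [htt, htv, Derivation.leibniz_pow]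
      linear_combination hc6)
    (by
      simp [hvt, hvv, Derivation.leibniz_pow]
      linear_combination hc7)
  refine ⟨![c0, c1, c2, c3, c4, c5, c6, c7], ?_, ?_⟩
  · simp only [flatFst, Matrix.cons_val]
    linear_combination hc0
  · simp only [flatSnd, Matrix.cons_val]
    linear_combination hc5

/-- Each constant is isolated by a derivative: c 4 is T_tv, then c 3 is S_tv, and so on down to the
constant terms. -/
theorem eq_zero_of_flat_eq_zero (hinj : Function.Injective (algebraMap k A))
    (htt : Dt t = 1) (hvt : Dv t = 0) (htv : Dt v = 0) (hvv : Dv v = 1)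
    {c : Fin 8 → k} (hT : flatFst t v c = 0) (hS : flatSnd t v c = 0) : c = 0 := by
  have two (D : Derivation k A A) : D (2 : A) = 0 := by exact_mod_cast D.map_natCast 2
  have hz : ∀ {a : k}, algebraMap k A a = 0 → a = 0 := fun h => hinj (by rw [h, map_zero])
  have hTt := congrArg Dt hT
  have hTv := congrArg Dv hT
  have hSt := congrArg Dt hS
  have hSv := congrArg Dv hS
  have hTtv := congrArg Dt hTv
  have hSvt := congrArg Dt hSv
  simp only [flatFst, flatSnd, map_add, Derivation.leibniz, Derivation.leibniz_pow,
    Derivation.map_algebraMap, htt, hvt, htv, hvv, smul_eq_mul, mul_zero, mul_one, add_zero,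
    zero_add, smul_zero, map_zero] at hT hS hTt hTv hSt hSv hTtv hSvt
  have c4 := hz hTtv
  simp only [c4, map_zero, zero_mul, add_zero] at hSvt
  have c3 := hz hSvt
  simp only [c3, c4, map_zero, zero_mul, add_zero] at hT hS hTt hTv hSt hSv
  have c1 := hz hTt
  have c2 := hz hTv
  have c6 := hz hSt
  have c7 := hz hSv
  simp only [c1, c2, c6, c7, map_zero, zero_mul, add_zero] at hT hS
  have c0 := hz hT
  have c5 := hz hS
  ext i
  fin_cases i <;> assumption

end Solution

end FlatCoordinates

end PointSymmetry

/-! ### The dimension of the symmetry algebra in flat coordinates. -/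

namespace PointSymmetry

open TopologicalSpace smoothAlgebra FlatCoordinates

section ZeroExt

variable {𝕜 : Type*} [RCLike 𝕜] {U : Opens (𝕜 × 𝕜)}

open Classical in
/-- The extension by zero of a smooth function to the plane. -/
noncomputable def zeroExt (f : smoothAlgebra U) (z : 𝕜 × 𝕜) : 𝕜 := if h : z ∈ U then f ⟨z, h⟩ else 0

theorem zeroExt_apply (f : smoothAlgebra U) (z : U) : zeroExt f z = f z := dif_pos z.2

theorem zeroExt_of_notMem (f : smoothAlgebra U) {z : 𝕜 × 𝕜} (hz : z ∉ U) : zeroExt f z = 0 :=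
  dif_neg hz

theorem contDiffOn_zeroExt (f : smoothAlgebra U) : ContDiffOn 𝕜 ∞ (zeroExt f) U :=
  (contDiffOn_rep f).congr fun z hz => by
    rw [rep_apply f ⟨z, hz⟩, zeroExt_apply f ⟨z, hz⟩]

theorem mk_zeroExt (f : smoothAlgebra U) : mk (zeroExt f) (contDiffOn_zeroExt f) = f :=
  smoothAlgebra.ext (zeroExt_apply f)

theorem zeroExt_add (f g : smoothAlgebra U) (z : 𝕜 × 𝕜) :
    zeroExt (f + g) z = zeroExt f z + zeroExt g z := by
  by_cases h : z ∈ U <;> simp [zeroExt, h]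

theorem zeroExt_smul (c : 𝕜) (f : smoothAlgebra U) (z : 𝕜 × 𝕜) :
    zeroExt (c • f) z = c * zeroExt f z := by
  by_cases h : z ∈ U <;> simp [zeroExt, h]

end ZeroExt

namespace FlatCoordinates

section Linear

variable {k A : Type*} [Field k] [CommRing A] [Algebra k A]

theorem flatFst_add (t v : A) (c d : Fin 8 → k) :
    flatFst t v (c + d) = flatFst t v c + flatFst t v d := by
  simp only [flatFst, Pi.add_apply, map_add]; ring

theorem flatSnd_add (t v : A) (c d : Fin 8 → k) :
    flatSnd t v (c + d) = flatSnd t v c + flatSnd t v d := by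
  simp only [flatSnd, Pi.add_apply, map_add]; ring

theorem flatFst_smul (t v : A) (r : k) (c : Fin 8 → k) :
    flatFst t v (r • c) = algebraMap k A r * flatFst t v c := by
  simp only [flatFst, Pi.smul_apply, smul_eq_mul, map_mul]; ring

theorem flatSnd_smul (t v : A) (r : k) (c : Fin 8 → k) :
    flatSnd t v (r • c) = algebraMap k A r * flatSnd t v c := by
  simp only [flatSnd, Pi.smul_apply, smul_eq_mul, map_mul]; ring

end Linear

variable {𝕜 : Type*} [RCLike 𝕜] {U : Opens (𝕜 × 𝕜)} {a b c t v τ ρ σ κ θ l m : smoothAlgebra U}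

/-- The symmetry with the flat components `flatFst t v e` and `flatSnd t v e`. -/
noncomputable def flatSymmetry (t v ρ κ θ : smoothAlgebra U) (e : Fin 8 → 𝕜) (z : 𝕜 × 𝕜) : 𝕜 × 𝕜 :=
  (zeroExt (ρ * flatFst t v e) z,
    zeroExt (κ * flatSnd t v e - θ * (ρ * flatFst t v e)) z)

/-- The map from the eight constants to the fields is a linear isomorphism. Connectedness enters
through surjectivity: a function with zero derivatives must be constant. -/
theorem finrank_symmetryAlgebra (h : FlatCoordinates (derX U) (derY U) a b c t v τ ρ σ κ θ l m)
    (hU : IsConnected (U : Set (𝕜 × 𝕜))) {F : 𝕜 × 𝕜 × 𝕜 × 𝕜 → 𝕜}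
    (hF : ∀ (X : 𝕜 × 𝕜 → 𝕜 × 𝕜) (hX : ContDiffOn 𝕜 ∞ X U), SatisfiesDetermining F U X ↔
      DeterminingEquations (derX U) (derY U) a b c
        (smoothAlgebra.mk (fun z => (X z).1) hX.fst) (smoothAlgebra.mk (fun z => (X z).2) hX.snd)) :
    Module.finrank 𝕜 (symmetryAlgebra F U U.isOpen) = 8 := by
  have hconst : ∀ f : smoothAlgebra U, derT (derX U) (derY U) ρ θ f = 0 →
      derV (derY U) κ f = 0 → ∃ c : 𝕜, f = algebraMap 𝕜 _ c := fun f h1 h2 =>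
    eq_algebraMap_of_der_eq_zero hU f (h.derT_eq_zero_iff h1 h2).1 (h.derT_eq_zero_iff h1 h2).2
  have hinj : Function.Injective (algebraMap 𝕜 (smoothAlgebra U)) := fun c d hcd => by
    obtain ⟨z, hz⟩ := hU.nonempty
    exact congrFun (congrArg Subtype.val hcd) ⟨z, hz⟩
  have hmem : ∀ e, flatSymmetry t v ρ κ θ e ∈ symmetryAlgebra F U U.isOpen := by
    intro e
    have hX : ContDiffOn 𝕜 ∞ (flatSymmetry t v ρ κ θ e) U :=
      (contDiffOn_zeroExt _).prodMk (contDiffOn_zeroExt _)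
    refine ⟨hX, fun z hz => ?_, (hF _ hX).2 ?_⟩
    · exact Prod.ext (zeroExt_of_notMem _ hz) (zeroExt_of_notMem _ hz)
    · have e1 : smoothAlgebra.mk (fun z => (flatSymmetry t v ρ κ θ e z).1) hX.fst = ρ * flatFst t v e :=
        mk_zeroExt _
      have e2 : smoothAlgebra.mk (fun z => (flatSymmetry t v ρ κ θ e z).2) hX.snd =
          κ * flatSnd t v e - θ * (ρ * flatFst t v e) := mk_zeroExt _
      rw [e1, e2, h.determiningEquations_iff]
      have e3 : τ * (ρ * flatFst t v e) = flatFst t v e := by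
        linear_combination flatFst t v e * h.τρ
      have e4 : σ * (θ * (ρ * flatFst t v e) +
          (κ * flatSnd t v e - θ * (ρ * flatFst t v e))) = flatSnd t v e := by
        linear_combination flatSnd t v e * h.σκ
      rw [e3, e4]
      exact flatEquations_flat h.derT_t h.derV_t h.derT_v h.derV_v e
  let L : (Fin 8 → 𝕜) →ₗ[𝕜] symmetryAlgebra F U U.isOpen :=
    { toFun := fun e => ⟨flatSymmetry t v ρ κ θ e, hmem e⟩
      map_add' := fun e e' => by
        refine Subtype.ext (funext fun z => Prod.ext ?_ ?_)
        · simp only [flatSymmetry, flatFst_add, mul_add, zeroExt_add, Submodule.coe_add,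
            Pi.add_apply, Prod.fst_add]
        · simp only [flatSymmetry, flatFst_add, flatSnd_add, Submodule.coe_add,
            Pi.add_apply, Prod.snd_add, ← zeroExt_add]
          congr 1; ring
      map_smul' := fun r e => by
        refine Subtype.ext (funext fun z => Prod.ext ?_ ?_)
        · simp only [flatSymmetry, flatFst_smul, SetLike.val_smul, Pi.smul_apply, Prod.smul_fst,
            smul_eq_mul, RingHom.id_apply]
          rw [← zeroExt_smul, Algebra.smul_def]
          congr 1; ring
        · simp only [flatSymmetry, flatFst_smul, flatSnd_smul, SetLike.val_smul, Pi.smul_apply,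
            Prod.smul_snd, smul_eq_mul, RingHom.id_apply]
          rw [← zeroExt_smul, Algebra.smul_def]
          congr 1; ring }
  have hL : Function.Bijective L := by
    constructor
    · refine (injective_iff_map_eq_zero L).2 fun e he => ?_
      have he : flatSymmetry t v ρ κ θ e = 0 := congrArg Subtype.val he
      have h1 : ρ * flatFst t v e = 0 := smoothAlgebra.ext fun z => by
        rw [← zeroExt_apply]
        exact congrArg Prod.fst (congrFun he z)
      have h2 : κ * flatSnd t v e - θ * (ρ * flatFst t v e) = 0 := smoothAlgebra.ext fun z => by
        rw [← zeroExt_apply]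
        exact congrArg Prod.snd (congrFun he z)
      have hT : flatFst t v e = 0 := by linear_combination τ * h1 - flatFst t v e * h.τρ
      have hS : flatSnd t v e = 0 := by
        rw [hT] at h2
        linear_combination σ * h2 - flatSnd t v e * h.σκ
      exact eq_zero_of_flat_eq_zero hinj h.derT_t h.derV_t h.derT_v h.derV_v hT hS
    · rintro ⟨X, hX, hX0, hXs⟩
      have hd := h.determiningEquations_iff.1 ((hF X hX).1 hXs)
      set ξ : smoothAlgebra U := smoothAlgebra.mk (fun z => (X z).1) hX.fst
      set φ : smoothAlgebra U := smoothAlgebra.mk (fun z => (X z).2) hX.snd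
      obtain ⟨e, hT, hS⟩ := hd.exists_eq_flat h.der_comm hconst h.derT_t h.derV_t h.derT_v h.derV_v
      have h1 : ρ * flatFst t v e = ξ := by
        rw [← hT]; linear_combination ξ * h.τρ
      have h2 : κ * flatSnd t v e - θ * (ρ * flatFst t v e) = φ := by
        rw [h1, ← hS]; linear_combination (θ * ξ + φ) * h.σκ
      refine ⟨e, Subtype.ext (funext fun z => ?_)⟩
      change (zeroExt _ z, zeroExt _ z) = X z
      rw [h2, h1]
      by_cases hz : z ∈ U
      · rw [zeroExt_apply ξ ⟨z, hz⟩, zeroExt_apply φ ⟨z, hz⟩]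
        rfl
      · rw [zeroExt_of_notMem _ hz, zeroExt_of_notMem _ hz, hX0 z hz]
        rfl
  rw [← (LinearEquiv.ofBijective L hL).finrank_eq]
  simp

end FlatCoordinates

end PointSymmetry

/-! ### Restriction to smaller open sets and primitives of closed forms. -/

namespace PointSymmetry

section Restriction

open TopologicalSpace smoothAlgebra

variable {𝕜 : Type*} [RCLike 𝕜] {U V : Opens (𝕜 × 𝕜)}

namespace smoothAlgebra

/-- The restriction of smooth functions to a smaller open set. -/
noncomputable def restrict (h : V ≤ U) : smoothAlgebra U →ₐ[𝕜] smoothAlgebra V where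
  toFun f := ⟨fun z => f ⟨z, h z.2⟩, rep f, (contDiffOn_rep f).mono h,
    fun z => (rep_apply f ⟨z, h z.2⟩).symm⟩
  map_one' := rfl
  map_mul' _ _ := rfl
  map_zero' := rfl
  map_add' _ _ := rfl
  commutes' _ := rfl

theorem restrict_apply (h : V ≤ U) (f : smoothAlgebra U) (z : V) :
    restrict h f z = f ⟨z, h z.2⟩ := rfl

theorem der_restrict (h : V ≤ U) (v : 𝕜 × 𝕜) (f : smoothAlgebra U) :
    der v (restrict h f) = restrict h (der v f) := by
  have hf : restrict h f = mk (rep f) ((contDiffOn_rep f).mono h) :=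
    ext fun z => (rep_apply f ⟨z, h z.2⟩).symm
  rw [hf, der_mk]
  rfl

/-- The Poincaré lemma on a convex open set of the plane. -/
theorem exists_der_eq (hU : Convex ℝ (U : Set (𝕜 × 𝕜))) {f g : smoothAlgebra U}
    (h : derY U f = derX U g) : ∃ p, derX U p = f ∧ derY U p = g := by
  let η : 𝕜 × 𝕜 → 𝕜 × 𝕜 →L[𝕜] 𝕜 := fun z =>
    rep f z • ContinuousLinearMap.fst 𝕜 𝕜 𝕜 + rep g z • ContinuousLinearMap.snd 𝕜 𝕜 𝕜
  have hη : ContDiffOn 𝕜 ∞ η U :=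
    ((contDiffOn_rep f).smul contDiffOn_const).add ((contDiffOn_rep g).smul contDiffOn_const)
  have hd : ∀ z ∈ U, HasFDerivAt η
      ((fderiv 𝕜 (rep f) z).smulRight (ContinuousLinearMap.fst 𝕜 𝕜 𝕜) +
        (fderiv 𝕜 (rep g) z).smulRight (ContinuousLinearMap.snd 𝕜 𝕜 𝕜)) z := fun z hz =>
    ((differentiableAt_of_contDiffOn (contDiffOn_rep f) ⟨z, hz⟩).hasFDerivAt.smul_const
      (ContinuousLinearMap.fst 𝕜 𝕜 𝕜)).add
      ((differentiableAt_of_contDiffOn (contDiffOn_rep g) ⟨z, hz⟩).hasFDerivAt.smul_const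
        (ContinuousLinearMap.snd 𝕜 𝕜 𝕜))
  obtain ⟨p, hp⟩ := hU.exists_forall_hasFDerivAt_of_fderiv_symmetric U.isOpen
    (show DifferentiableOn ℝ η U from
      fun z hz => ((hd z hz).restrictScalars ℝ).differentiableAt.differentiableWithinAt)
    (fun z hz x y => by
      have e : fderiv 𝕜 (rep f) z (0, 1) = fderiv 𝕜 (rep g) z (1, 0) :=
        congrFun (congrArg Subtype.val h) ⟨z, hz⟩
      rw [((hd z hz).restrictScalars ℝ).fderiv]
      simp only [ContinuousLinearMap.coe_restrictScalars', add_apply,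
        ContinuousLinearMap.smulRight_apply, smul_apply,
        ContinuousLinearMap.coe_fst', ContinuousLinearMap.coe_snd', smul_eq_mul]
      obtain ⟨x₁, x₂⟩ := x
      obtain ⟨y₁, y₂⟩ := y
      rw [fderiv_apply_pair _ _ x₁, fderiv_apply_pair _ _ x₁, fderiv_apply_pair _ _ y₁,
        fderiv_apply_pair _ _ y₁]
      linear_combination (x₂ * y₁ - x₁ * y₂) * e)
  have hps : ContDiffOn 𝕜 ∞ p U := (contDiffOn_infty_iff_fderiv_of_isOpen U.isOpen).2
    ⟨fun z hz => (hp z hz).differentiableAt.differentiableWithinAt,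
      hη.congr fun z hz => (hp z hz).fderiv⟩
  refine ⟨mk p hps, ?_, ?_⟩ <;> ext z <;>
    simp [der_mk, (hp z z.2).fderiv, η, rep_apply]

end smoothAlgebra

/-- An arbitrary connected V need not be convex, so primitives cannot be constructed on it directly;
it receives its flat coordinates by restriction from a ball. -/
theorem FlatCoordinates.map {k A B : Type*} [Field k] [CommRing A] [Algebra k A] [CommRing B]
    [Algebra k B] {D E : Derivation k A A} {D' E' : Derivation k B B}
    {a b c t v τ ρ σ κ θ l m : A} (h : FlatCoordinates D E a b c t v τ ρ σ κ θ l m)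
    (F : A →ₐ[k] B) (hD : ∀ f, D' (F f) = F (D f)) (hE : ∀ f, E' (F f) = F (E f))
    (hc : ∀ f, E' (D' f) = D' (E' f)) :
    FlatCoordinates D' E' (F a) (F b) (F c) (F t) (F v) (F τ) (F ρ) (F σ) (F κ) (F θ) (F l)
      (F m) where
  comm := hc
  tx := by rw [hD, h.tx]
  ty := by rw [hE, h.ty, map_zero]
  vx := by rw [hD, h.vx, map_mul]
  vy := by rw [hE, h.vy]
  τρ := by rw [← map_mul, h.τρ, map_one]
  σκ := by rw [← map_mul, h.σκ, map_one]
  τx := by rw [hD, h.τx, map_mul]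
  σx := by rw [hD, h.σx, map_mul]
  σy := by rw [hE, h.σy, map_neg, map_mul]
  b_eq := by rw [h.b_eq]; simp [map_ofNat]
  θx := by rw [hD, h.θx]; simp

end Restriction

end PointSymmetry

/-! ### Termwise differentiation of power series over ℝ or ℂ. -/

section PowerSeries

variable {𝕜 : Type*} [RCLike 𝕜] {c : ℕ → 𝕜} {r M : ℝ}

/-- Halving the radius absorbs the factor n + 1, because n + 1 ≤ 2^n. The same bound then applies to
the differentiated series. -/
theorem norm_coeff_succ_le (hr : 0 < r) (hc : ∀ n, ‖c n‖ * r ^ n ≤ M) (n : ℕ) :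
    ‖(n + 1) * c (n + 1)‖ * (r / 2) ^ n ≤ M / r := by
  have h1 : ((n : ℝ) + 1) ≤ 2 ^ n := by exact_mod_cast Nat.lt_two_pow_self
  have h2 : ‖((n : 𝕜) + 1)‖ = n + 1 := by
    rw [← Nat.cast_succ, RCLike.norm_natCast, Nat.cast_succ]
  rw [norm_mul, h2, le_div_iff₀ hr, div_pow]
  calc (n + 1) * ‖c (n + 1)‖ * (r ^ n / 2 ^ n) * r
      = (n + 1) / 2 ^ n * (‖c (n + 1)‖ * r ^ (n + 1)) := by ring
    _ ≤ 1 * (‖c (n + 1)‖ * r ^ (n + 1)) := by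
        gcongr
        exact (div_le_one (by positivity)).2 h1
    _ ≤ M := by rw [one_mul]; exact hc _

theorem summable_mul_pow (hr : 0 < r) (hc : ∀ n, ‖c n‖ * r ^ n ≤ M) {s : 𝕜} (hs : ‖s‖ < r) :
    Summable fun n => c n * s ^ n := by
  refine Summable.of_norm_bounded (g := fun n => M * (‖s‖ / r) ^ n)
    ((summable_geometric_of_lt_one (by positivity) ((div_lt_one hr).2 hs)).mul_left M) fun n => ?_
  rw [norm_mul, norm_pow, div_pow]
  calc ‖c n‖ * ‖s‖ ^ n = ‖c n‖ * r ^ n * (‖s‖ ^ n / r ^ n) := by field_simp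
    _ ≤ M * (‖s‖ ^ n / r ^ n) := by gcongr; exact hc n

theorem hasSum_nat_mul_pow {s S : 𝕜} (h : HasSum (fun n : ℕ => (n + 1) * c (n + 1) * s ^ n) S) :
    HasSum (fun n : ℕ => n * c n * s ^ n) (s * S) := by
  rw [← hasSum_nat_add_iff' 1]
  simp only [Finset.range_one, Finset.sum_singleton, Nat.cast_zero, zero_mul, sub_zero]
  have e : (fun n : ℕ => ((n + 1 : ℕ) : 𝕜) * c (n + 1) * s ^ (n + 1)) =
      fun n : ℕ => s * ((n + 1) * c (n + 1) * s ^ n) := by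
    funext n
    push_cast
    ring
  rw [e]
  exact h.mul_left s

theorem hasDerivAt_tsum_mul_pow (hr : 0 < r) (hc : ∀ n, ‖c n‖ * r ^ n ≤ M) {s : 𝕜}
    (hs : ‖s‖ < r / 2) :
    HasDerivAt (fun s => ∑' n, c n * s ^ n) (∑' n : ℕ, (n + 1) * c (n + 1) * s ^ n) s := by
  obtain ⟨ρ, hρ, hρr⟩ := exists_between hs
  have hρ0 : 0 ≤ ρ := (norm_nonneg s).trans hρ.le
  have hu : Summable fun n : ℕ => ‖(n : 𝕜) * c n‖ * ρ ^ (n - 1) := by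
    rw [← summable_nat_add_iff 1]
    have h := (summable_mul_pow (c := fun n : ℕ => (n + 1) * c (n + 1)) (half_pos hr)
      (norm_coeff_succ_le hr hc) (s := (ρ : 𝕜)) (by simpa [abs_of_nonneg hρ0] using hρr)).norm
    refine h.congr fun n => ?_
    simp [abs_of_nonneg hρ0]
  have h := hasDerivAt_tsum_of_isPreconnected (t := Metric.ball (0 : 𝕜) ρ) (y₀ := 0) (y := s)
    (g := fun n s => c n * s ^ n) (g' := fun n s => c n * (n * s ^ (n - 1))) hu
    Metric.isOpen_ball (convex_ball (0 : 𝕜) ρ).isPreconnected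
    (fun n y _ => (hasDerivAt_pow n y).const_mul _)
    (fun n y hy => by
      rw [mem_ball_zero_iff] at hy
      rw [mul_left_comm, ← mul_assoc, norm_mul _ (y ^ _), norm_pow]
      gcongr)
    (by simpa using (norm_nonneg s).trans_lt hρ)
    (summable_mul_pow hr hc (by simpa using hr)) (by simpa using hρ)
  refine h.congr_deriv ?_
  have h0 : ∑ i ∈ Finset.range 1, c i * (i * s ^ (i - 1)) = 0 := by simp
  rw [← Summable.sum_add_tsum_nat_add' (k := 1), h0, zero_add]
  · refine tsum_congr fun n => ?_
    simp
    ring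
  · refine (summable_mul_pow (c := fun n : ℕ => (n + 1) * c (n + 1)) (half_pos hr)
      (norm_coeff_succ_le hr hc) hs).congr fun n => ?_
    simp
    ring

end PowerSeries

/-! ### A local solution of the Picard–Fuchs equation. -/

namespace PainleveVI

variable {𝕜 : Type*} [RCLike 𝕜]

/-- The power series coefficients, at the point `x`, of the solution of
`x (1 - x) K'' + (1 - 2 x) K' - K / 4 = 0` with initial values `1`, `0`. -/
noncomputable def ellipticCoeff (x : 𝕜) : ℕ → 𝕜
  | 0 => 1
  | 1 => 0
  | n + 2 => ((n + 1 / 2) ^ 2 * ellipticCoeff x n -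
      (1 - 2 * x) * (n + 1) ^ 2 * ellipticCoeff x (n + 1)) / (x * (1 - x) * (n + 2) * (n + 1))

theorem ellipticCoeff_rec {x : 𝕜} (h0 : x ≠ 0) (h1 : x ≠ 1) (n : ℕ) :
    x * (1 - x) * ((n + 1) * ((n + 2) * ellipticCoeff x (n + 2))) =
      (n + 1 / 2) ^ 2 * ellipticCoeff x n -
        (1 - 2 * x) * (n + 1) ^ 2 * ellipticCoeff x (n + 1) := by
  have h1 := sub_ne_zero.2 h1.symm
  have h2 : (n : 𝕜) + 1 ≠ 0 := Nat.cast_add_one_ne_zero n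
  have h3 : (n : 𝕜) + 2 ≠ 0 := by exact_mod_cast Nat.succ_ne_zero (n + 1)
  rw [ellipticCoeff]
  field_simp

theorem norm_ellipticCoeff_le {x : 𝕜} (h0 : x ≠ 0) (h1 : x ≠ 1) :
    ∃ R : ℝ, 1 ≤ R ∧ ∀ n, ‖ellipticCoeff x n‖ ≤ R ^ n := by
  have h2 := sub_ne_zero.2 h1.symm
  have hp : 0 < ‖x * (1 - x)‖ := norm_pos_iff.2 (mul_ne_zero h0 h2)
  -- Since |n + 1/2| ≤ n + 1, C bounds the sum of the two coefficient ratios of the recurrence. R =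
  -- 1 + C satisfies R ≥ 1, so that R^n ≤ R^(n+1), and C ≤ R closes the induction.
  set C : ℝ := (1 + ‖1 - 2 * x‖) / ‖x * (1 - x)‖ with hC
  have hC0 : 0 ≤ C := by positivity
  have hCx : C * ‖x * (1 - x)‖ = 1 + ‖1 - 2 * x‖ := by rw [hC]; field_simp
  refine ⟨1 + C, by linarith, fun n => ?_⟩
  induction n using Nat.twoStepInduction with
  | zero => simp [ellipticCoeff]
  | one => simp only [ellipticCoeff, norm_zero]; positivity
  | more n ih1 ih2 =>
    have hn : ‖(n : 𝕜) + 1‖ = n + 1 := by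
      rw [← Nat.cast_succ, RCLike.norm_natCast, Nat.cast_succ]
    have hn2 : ‖(n : 𝕜) + 2‖ = n + 2 := by
      have := RCLike.norm_natCast (K := 𝕜) (n + 2)
      push_cast at this
      exact this
    have hh : ‖(n : 𝕜) + 1 / 2‖ ≤ n + 1 := by
      refine (norm_add_le _ _).trans ?_
      rw [RCLike.norm_natCast, norm_div, norm_one, RCLike.norm_ofNat]
      linarith
    have h := congrArg norm (ellipticCoeff_rec h0 h1 n)
    rw [norm_mul, norm_mul ((n : 𝕜) + 1), norm_mul ((n : 𝕜) + 2), hn, hn2] at h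
    have h3 : ‖((n : 𝕜) + 1 / 2) ^ 2 * ellipticCoeff x n -
        (1 - 2 * x) * (n + 1) ^ 2 * ellipticCoeff x (n + 1)‖ ≤
        (n + 1) ^ 2 * (1 + C) ^ n + ‖1 - 2 * x‖ * (n + 1) ^ 2 * (1 + C) ^ (n + 1) := by
      refine (norm_sub_le _ _).trans ?_
      simp only [norm_mul, norm_pow, hn]
      gcongr
    rw [← h] at h3
    have h4 : (1 + C) ^ n ≤ (1 + C) ^ (n + 1) :=
      pow_le_pow_right₀ (by linarith) (Nat.le_succ n)
    have h5 : (0 : ℝ) ≤ (1 + C) ^ n := by positivity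
    have h6 : (n + 1 : ℝ) ^ 2 * (1 + C) ^ n + ‖1 - 2 * x‖ * (n + 1) ^ 2 * (1 + C) ^ (n + 1) ≤
        (n + 1) ^ 2 * (C * ‖x * (1 - x)‖ * (1 + C) ^ (n + 1)) := by
      rw [hCx]
      nlinarith [mul_le_mul_of_nonneg_left h4 (sq_nonneg (n + 1 : ℝ))]
    have h7 : (n + 1 : ℝ) ^ 2 * (C * ‖x * (1 - x)‖ * (1 + C) ^ (n + 1)) ≤
        (n + 1) * (n + 2) * (‖x * (1 - x)‖ * (1 + C) ^ (n + 2)) := by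
      have : (n + 1 : ℝ) ^ 2 ≤ (n + 1) * (n + 2) := by nlinarith
      calc _ ≤ (n + 1 : ℝ) * (n + 2) * ((1 + C) * ‖x * (1 - x)‖ * (1 + C) ^ (n + 1)) := by
            gcongr; linarith
        _ = _ := by ring
    have h8 := (h3.trans h6).trans h7
    refine le_of_mul_le_mul_left ?_ (show 0 < (n + 1 : ℝ) * (n + 2) * ‖x * (1 - x)‖ by positivity)
    linarith

/-- At the base point x, (x+s)(1-x-s) = x(1-x) + (1-2x)s - s². The coefficient of s^n in the
equation combines n(n-1) + 2n + 1/4 = (n + 1/2)² and n(n+1) + (n+1) = (n+1)², which is the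
recurrence. -/
theorem elliptic_identity {k : ℕ → 𝕜} {x s S₀ S₁ S₂ : 𝕜}
    (hk : ∀ n : ℕ, x * (1 - x) * ((n + 1) * ((n + 2) * k (n + 2))) =
      (n + 1 / 2) ^ 2 * k n - (1 - 2 * x) * (n + 1) ^ 2 * k (n + 1))
    (h₀ : HasSum (fun n => k n * s ^ n) S₀)
    (h₁ : HasSum (fun n : ℕ => (n + 1) * k (n + 1) * s ^ n) S₁)
    (h₂ : HasSum (fun n : ℕ => (n + 1) * ((n + 2) * k (n + 2)) * s ^ n) S₂) :
    (x + s) * (1 - (x + s)) * S₂ = S₀ / 4 - (1 - 2 * (x + s)) * S₁ := by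
  have h₃ := hasSum_nat_mul_pow h₁
  have h₄ : HasSum (fun n : ℕ => n * ((n + 1) * k (n + 1)) * s ^ n) (s * S₂) :=
    hasSum_nat_mul_pow (c := fun n : ℕ => (n + 1) * k (n + 1)) <| h₂.congr_fun fun n => by
      push_cast; ring
  have h₅ : HasSum (fun n : ℕ => n * ((n - 1) * k n) * s ^ n) (s * (s * S₂)) :=
    hasSum_nat_mul_pow (c := fun n : ℕ => (n - 1) * k n) <| h₄.congr_fun fun n => by
      push_cast; ring
  have h := (((h₂.mul_left (x * (1 - x))).add (h₄.mul_left (1 - 2 * x))).sub h₅).add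
    ((h₁.mul_left (1 - 2 * x)).sub ((h₃.mul_left 2).add (h₀.mul_left (1 / 4))))
  have h0 := h.unique (hasSum_zero.congr_fun fun n => by linear_combination s ^ n * hk n)
  linear_combination h0

/-- The equation `x (1 - x) K'' + (1 - 2 x) K' - K / 4 = 0` of the complete elliptic integrals
has a nonvanishing smooth solution near each point other than `0` and `1`. -/
theorem exists_elliptic {x₀ : 𝕜} (h0 : x₀ ≠ 0) (h1 : x₀ ≠ 1) :
    ∃ K K' : 𝕜 → 𝕜, ∃ r > 0, ∀ x ∈ Metric.ball x₀ r, K x ≠ 0 ∧ HasDerivAt K (K' x) x ∧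
      HasDerivAt K' ((K x / 4 - (1 - 2 * x) * K' x) / (x * (1 - x))) x := by
  obtain ⟨R, hR, hk⟩ := norm_ellipticCoeff_le h0 h1
  set k := ellipticCoeff x₀
  have hR0 : 0 < R := by linarith
  have b0 : ∀ n, ‖k n‖ * R⁻¹ ^ n ≤ 1 := fun n => by
    rw [inv_pow, ← div_eq_mul_inv, div_le_one (by positivity)]
    exact hk n
  have r0 : 0 < R⁻¹ := by positivity
  have b1 := norm_coeff_succ_le r0 b0
  have r1 := half_pos r0
  have b2 := norm_coeff_succ_le (c := fun n : ℕ => (n + 1) * k (n + 1)) r1 b1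
  have r2 := half_pos r1
  set f : 𝕜 → 𝕜 := fun s => ∑' n, k n * s ^ n with hf
  set f' : 𝕜 → 𝕜 := fun s => ∑' n : ℕ, (n + 1) * k (n + 1) * s ^ n with hf'
  have d0 : ∀ s : 𝕜, ‖s‖ < R⁻¹ / 2 → HasDerivAt f (f' s) s := fun s hs =>
    hasDerivAt_tsum_mul_pow r0 b0 hs
  have d1 : ∀ s : 𝕜, ‖s‖ < R⁻¹ / 2 / 2 → HasDerivAt f'
      (∑' n : ℕ, (n + 1) * ((↑(n + 1) + 1) * k (n + 1 + 1)) * s ^ n) s := fun s hs =>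
    hasDerivAt_tsum_mul_pow (c := fun n : ℕ => (n + 1) * k (n + 1)) r1 b1 hs
  have key : ∀ s : 𝕜, ‖s‖ < R⁻¹ / 2 / 2 → (x₀ + s) * (1 - (x₀ + s)) *
      (∑' n : ℕ, (n + 1) * ((↑(n + 1) + 1) * k (n + 1 + 1)) * s ^ n) =
      f s / 4 - (1 - 2 * (x₀ + s)) * f' s := fun s hs =>
    elliptic_identity (ellipticCoeff_rec h0 h1) (summable_mul_pow r0 b0 (by linarith)).hasSum
      (summable_mul_pow r1 b1 (by linarith)).hasSum <|
      (summable_mul_pow r2 b2 (by linarith)).hasSum.congr_fun fun n => by push_cast; ring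
  -- The initial value 1 makes the solution nonvanishing near the base point.
  have f0 : f 0 ≠ 0 := by
    have : f 0 = k 0 := by
      rw [hf]
      simp only
      rw [tsum_eq_single 0 fun n hn => by simp [hn]]
      simp
    rw [this]
    simp [k, ellipticCoeff]
  obtain ⟨ε, hε, hfε⟩ := Metric.eventually_nhds_iff_ball.1
    ((d0 0 (by simpa using r1)).continuousAt.eventually_ne f0)
  have hx : ∀ᶠ x in nhds x₀, x ≠ 0 ∧ x ≠ 1 :=
    (continuousAt_id.eventually_ne h0).and (continuousAt_id.eventually_ne h1)
  obtain ⟨η, hη, hxη⟩ := Metric.eventually_nhds_iff_ball.1 hx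
  refine ⟨fun x => f (x - x₀), fun x => f' (x - x₀), min ε (min η (R⁻¹ / 2 / 2)),
    by positivity, fun x hx => ?_⟩
  have hx1 : ‖x - x₀‖ < ε := (mem_ball_iff_norm.1 hx).trans_le (min_le_left _ _)
  have hx2 : x ∈ Metric.ball x₀ η :=
    Metric.ball_subset_ball ((min_le_right _ _).trans (min_le_left _ _)) hx
  have hx3 : ‖x - x₀‖ < R⁻¹ / 2 / 2 :=
    (mem_ball_iff_norm.1 hx).trans_le ((min_le_right _ _).trans (min_le_right _ _))
  obtain ⟨hx0, hx1'⟩ := hxη x hx2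
  have hx1' := sub_ne_zero.2 hx1'.symm
  refine ⟨hfε _ (by simpa using hx1), (d0 _ (by linarith)).comp_sub_const x x₀, ?_⟩
  refine ((d1 _ hx3).comp_sub_const x x₀).congr_deriv ?_
  rw [eq_div_iff (mul_ne_zero hx0 hx1')]
  have := key _ hx3
  rw [add_sub_cancel] at this
  rw [← this]
  ring

end PainleveVI

/-! ### Functions of x alone and exponentials in the smooth algebra. -/

namespace PointSymmetry.smoothAlgebra

open TopologicalSpace

variable {𝕜 : Type*} [RCLike 𝕜] {U : Opens (𝕜 × 𝕜)}

theorem derX_mk_comp_fst {f f' : 𝕜 → 𝕜} (h : ContDiffOn 𝕜 ∞ (fun z : 𝕜 × 𝕜 => f z.1) U)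
    (h' : ContDiffOn 𝕜 ∞ (fun z : 𝕜 × 𝕜 => f' z.1) U)
    (hf : ∀ z ∈ U, HasDerivAt f (f' z.1) z.1) :
    derX U (mk _ h) = mk _ h' ∧ derY U (mk _ h) = 0 := by
  have e : ∀ z : U, fderiv 𝕜 (fun z : 𝕜 × 𝕜 => f z.1) z =
      f' z.1.1 • ContinuousLinearMap.fst 𝕜 𝕜 𝕜 := fun z =>
    ((hf z z.2).comp_hasFDerivAt (z : 𝕜 × 𝕜) hasFDerivAt_fst).fderiv
  constructor <;> ext z <;> simp [der_mk, e]

/-- This yields 1/√P as the exponential of a primitive, without the choice of a branch of the root.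
-/
theorem exists_exp (f : smoothAlgebra U) :
    ∃ r : smoothAlgebra U, (∀ z, r z ≠ 0) ∧ ∀ v : 𝕜 × 𝕜, der (U := U) v r = r * der (U := U) v f := by
  have hs : ContDiff 𝕜 ∞ (NormedSpace.exp : 𝕜 → 𝕜) := contDiff_iff_contDiffAt.2 fun x =>
    (NormedSpace.exp_analytic (𝕂 := 𝕜) x).contDiffAt
  refine ⟨mk (fun z => NormedSpace.exp (rep f z)) (hs.comp_contDiffOn (contDiffOn_rep f)),
    fun z => ?_, fun v => ?_⟩
  · refine (NormedSpace.isUnit_exp_of_mem_ball (𝕂 := 𝕜) ?_).ne_zero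
    exact (NormedSpace.expSeries_radius_eq_top 𝕜 𝕜).symm ▸ edist_lt_top _ _
  · rw [der_mk]
    ext z
    have h := (hasDerivAt_exp (𝕂 := 𝕜) (x := rep f z)).comp_hasFDerivAt (z : 𝕜 × 𝕜)
      (differentiableAt_of_contDiffOn (contDiffOn_rep f) z).hasFDerivAt
    simp only [mk_apply, Subalgebra.coe_mul, Pi.mul_apply, der_apply]
    erw [h.fderiv]
    rfl

end PointSymmetry.smoothAlgebra

/-! ### Flat coordinates for the parameters (0, 0, 0, 1/2). -/

namespace PainleveVI

open PointSymmetry TopologicalSpace smoothAlgebra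

variable {𝕜 : Type*} [RCLike 𝕜]

/-- The first-order system expresses the derivatives of K and K' through K, K' and x, so each degree
of smoothness yields the next. -/
theorem contDiffOn_of_elliptic {s : Set 𝕜} (hs : IsOpen s) (h0 : ∀ x ∈ s, x ≠ 0)
    (h1 : ∀ x ∈ s, x ≠ 1) {K K' : 𝕜 → 𝕜} (hK : ∀ x ∈ s, HasDerivAt K (K' x) x)
    (hK' : ∀ x ∈ s, HasDerivAt K' ((K x / 4 - (1 - 2 * x) * K' x) / (x * (1 - x))) x) :
    ContDiffOn 𝕜 ∞ K s ∧ ContDiffOn 𝕜 ∞ K' s := by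
  have h : ∀ n : ℕ, ContDiffOn 𝕜 n K s ∧ ContDiffOn 𝕜 n K' s := by
    intro n
    induction n with
    | zero =>
      exact ⟨contDiffOn_zero.2 fun x hx => (hK x hx).continuousAt.continuousWithinAt,
        contDiffOn_zero.2 fun x hx => (hK' x hx).continuousAt.continuousWithinAt⟩
    | succ n ih =>
      obtain ⟨i0, i1⟩ := ih
      rw [Nat.cast_succ, contDiffOn_succ_iff_deriv_of_isOpen hs,
        contDiffOn_succ_iff_deriv_of_isOpen hs]
      refine ⟨⟨fun x hx => (hK x hx).differentiableAt.differentiableWithinAt, by simp,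
        i1.congr fun x hx => (hK x hx).deriv⟩,
        fun x hx => (hK' x hx).differentiableAt.differentiableWithinAt, by simp, ?_⟩
      refine ContDiffOn.congr (f := fun x => (K x / 4 - (1 - 2 * x) * K' x) / (x * (1 - x))) ?_
        fun x hx => (hK' x hx).deriv
      exact ((i0.div_const 4).sub ((by fun_prop : ContDiffOn 𝕜 n (fun x => 1 - 2 * x) s).mul
        i1)).div (by fun_prop) fun x hx => mul_ne_zero (h0 x hx) (sub_ne_zero.2 (h1 x hx).symm)
  exact ⟨contDiffOn_infty.2 fun n => (h n).1, contDiffOn_infty.2 fun n => (h n).2⟩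

-- The coordinates are v = u/K with u_y = r = P^(-1/2), and dt = dx/(x(x-1)K²). Convexity of U
-- supplies each of them as a primitive of a closed form.
set_option maxHeartbeats 1000000 in
theorem exists_flatCoordinates_of_elliptic {U : Opens (𝕜 × 𝕜)}
    (hU : (U : Set (𝕜 × 𝕜)) ⊆ regularSet 𝕜) (hc : Convex ℝ (U : Set (𝕜 × 𝕜)))
    {K K' : smoothAlgebra U} (hK : ∀ z, K z ≠ 0) (hx : derX U K = K') (hy : derY U K = 0)
    (hx' : derX U K' = -(invX hU * invX₁ hU *
      (algebraMap 𝕜 _ (1 / 4) * K - (1 - 2 * coordX U) * K'))) :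
    ∃ t v τ ρ σ κ θ l m : smoothAlgebra U, FlatCoordinates (derX U) (derY U) (smoothA hU)
      (smoothB hU) (smoothC hU 0 0 0 (1 / 2)) t v τ ρ σ κ θ l m := by
  set half : smoothAlgebra U := algebraMap 𝕜 _ (1 / 2) with hhalf
  have nz : ∀ z : U, z.1.1 ≠ 0 ∧ z.1.1 - 1 ≠ 0 ∧ z.1.2 ≠ 0 ∧ z.1.2 - 1 ≠ 0 ∧
      z.1.2 - z.1.1 ≠ 0 := fun z =>
    ⟨(hU z.2).1, sub_ne_zero.2 (hU z.2).2.1, (hU z.2).2.2.1, sub_ne_zero.2 (hU z.2).2.2.2.1,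
      sub_ne_zero.2 (hU z.2).2.2.2.2⟩
  -- ℓ is -½ log P up to a constant, so r = exp ℓ is a constant multiple of 1/√P.
  obtain ⟨ℓ, hℓx, hℓy⟩ := exists_der_eq hc (f := half * invYX hU) (g := -smoothA hU) (by
    rw [map_neg, derX_smoothA]
    simp only [Derivation.leibniz, hhalf, Derivation.map_algebraMap, derY_invYX, smul_eq_mul]
    ring)
  obtain ⟨r, hr, hrv⟩ := exists_exp ℓ
  have hrx := hrv (1, 0)
  have hry := hrv (0, 1)
  rw [hℓx] at hrx
  rw [hℓy] at hry
  -- g stands for x(x-1)(K u_x - K' u). The form is closed because K solves the Picard–Fuchs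
  -- equation and the corresponding operator sends r to an exact derivative: x(x-1)r_xx + (2x-1)r_x
  -- + r/4 = -∂_y(r y(y-1)/(2(y-x))).
  obtain ⟨g, hgx, hgy⟩ := exists_der_eq hc
    (f := -(half * K * r * (coordY U * (coordY U - 1)) * invYX hU))
    (g := coordX U * (coordX U - 1) * (half * K * invYX hU - K') * r) (by
      simp only [Derivation.leibniz, map_sub, map_neg, hhalf, Derivation.map_algebraMap, hrx, hry,
        hx, hy, hx', derY_coordY, derX_coordX, derY_invYX, derX_invYX,
        Derivation.map_one_eq_zero, smul_eq_mul]
      ext z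
      obtain ⟨n0, n1, n2, n3, n4⟩ := nz z
      simp [smoothA]
      field_simp
      ring)
  set L := smoothAlgebra.inv K hK with hL
  have hKL : K * L = 1 := smoothAlgebra.mul_inv K hK
  have hLa : ∀ z, L z = (K z)⁻¹ := inv_apply K hK
  have hLx : derX U L = -L ^ 2 * K' := by rw [hL, der_inv, hx]
  have hLy : derY U L = 0 := by rw [hL, der_inv, hy, mul_zero]
  set R := smoothAlgebra.inv r hr with hR
  have hrR : r * R = 1 := smoothAlgebra.mul_inv r hr
  have hRa : ∀ z, R z = (r z)⁻¹ := inv_apply r hr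
  have hRx : derX U R = -R * (half * invYX hU) := by
    rw [hR, der_inv, hrx, ← hR]
    linear_combination (-R * (half * invYX hU)) * hrR
  set τ := invX hU * invX₁ hU * L ^ 2 with hτ
  have hτx : derX U τ = τ * (-(invX hU + invX₁ hU) - 2 * K' * L) := by
    simp only [hτ, Derivation.leibniz, Derivation.leibniz_pow, derX_invX, derX_invX₁, hLx,
      smul_eq_mul, nsmul_eq_mul]
    push_cast
    ring
  have hτy : derY U τ = 0 := by
    simp [hτ, Derivation.leibniz, Derivation.leibniz_pow, derY_invX, derY_invX₁, hLy]
  obtain ⟨t, htx, hty⟩ := exists_der_eq hc (f := τ) (g := 0) (by rw [hτy, map_zero])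
  have hσx : derX U (r * L) = r * L * (half * invYX hU - K' * L) := by
    rw [Derivation.leibniz, hLx, hrx, smul_eq_mul, smul_eq_mul]
    ring
  -- Closedness is (r/K)_x = (K r_x - K' r)/K² = g_y τ.
  obtain ⟨v, hvx, hvy⟩ := exists_der_eq hc (f := g * τ) (g := r * L) (by
    rw [hσx, Derivation.leibniz, hτy, hgy, smul_zero, zero_add, smul_eq_mul, hτ]
    ext z
    obtain ⟨n0, n1, n2, n3, n4⟩ := nz z
    have n5 := hK z
    simp [hLa]
    field_simp)
  have hσκ : r * L * (K * R) = 1 := by linear_combination K * L * hrR + hKL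
  refine ⟨t, v, τ, coordX U * (coordX U - 1) * K ^ 2, r * L, K * R, g * τ * (K * R),
    -(invX hU + invX₁ hU) - 2 * K' * L, half * invYX hU - K' * L, fun f => der_comm _ _ f,
    htx, hty, ?_, hvy, ?_, hσκ, hτx, hσx, ?_, ?_, ?_⟩
  · rw [hvx]
    linear_combination (-g * τ) * hσκ
  · ext z
    obtain ⟨n0, n1, n2, n3, n4⟩ := nz z
    have n5 := hK z
    simp [hτ, hLa]
    field_simp
  · rw [Derivation.leibniz, hLy, hry, smul_zero, zero_add, smul_eq_mul]
    ring
  · ext z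
    simp [smoothB, hhalf]
    ring
  -- The parameters enter only here: the contribution of g_x to θ_x is exactly -c.
  · have hC : half * K * r * (coordY U * (coordY U - 1)) * invYX hU * τ * (K * R) =
        smoothC hU 0 0 0 (1 / 2) := by
      ext z
      obtain ⟨n0, n1, n2, n3, n4⟩ := nz z
      have n5 := hK z
      have n6 := hr z
      simp [hτ, hhalf, hLa, hRa, smoothC]
      field_simp
    rw [Derivation.leibniz, Derivation.leibniz, Derivation.leibniz, hgx, hx, hRx, hτx]
    simp only [smul_eq_mul]
    linear_combination -hC - g * τ * K' * R * hKL

end PainleveVI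

/-! ### The linearizing point transformation. -/

namespace PointSymmetry

open TopologicalSpace smoothAlgebra

variable {𝕜 : Type*} [RCLike 𝕜] {U : Opens (𝕜 × 𝕜)}

theorem totalDeriv_rep (f : smoothAlgebra U) (z : U) (p : 𝕜) :
    totalDeriv (rep f) (z.1.1, z.1.2, p) = derX U f z + p * derY U f z := totalDeriv_eq _ _

theorem totalDeriv₁_totalDeriv_rep (f : smoothAlgebra U) (z : U) (p q : 𝕜) :
    HasFDerivAt (totalDeriv (rep f)) (fderiv 𝕜 (totalDeriv (rep f)) (z.1.1, z.1.2, p))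
      (z.1.1, z.1.2, p) ∧
    totalDeriv₁ (totalDeriv (rep f)) (z.1.1, z.1.2, p, q) =
      derX U (derX U f) z + p * (derY U (derX U f) z + derX U (derY U f) z) +
        p ^ 2 * derY U (derY U f) z + q * derY U f z := by
  have hd : ∀ v : 𝕜 × 𝕜, ContDiffOn 𝕜 ∞ (fun z => fderiv 𝕜 (rep f) z v) U := fun v =>
    contDiffOn_fderiv_apply (contDiffOn_rep f) v
  have e : ∀ v w : 𝕜 × 𝕜, der (U := U) w (der (U := U) v f) z =
      fderiv 𝕜 (fun z => fderiv 𝕜 (rep f) z v) z w := fun v w =>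
    congrArg (fun g => g w) (fderiv_rep_mk _ (hd v) z)
  rw [e, e, e, e]
  exact totalDeriv₁_totalDeriv (differentiableAt_of_contDiffOn (hd _) z)
    (differentiableAt_of_contDiffOn (hd _) z)

theorem transformedDeriv₂_eq {T V : 𝕜 × 𝕜 → 𝕜} {x y p q : 𝕜}
    (hV : HasFDerivAt (totalDeriv V) (fderiv 𝕜 (totalDeriv V) (x, y, p)) (x, y, p))
    (hT : HasFDerivAt (totalDeriv T) (fderiv 𝕜 (totalDeriv T) (x, y, p)) (x, y, p))
    (h0 : totalDeriv T (x, y, p) ≠ 0) :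
    transformedDeriv₂ (fun z => (T z, V z)) (x, y, p, q) =
      (totalDeriv₁ (totalDeriv V) (x, y, p, q) * totalDeriv T (x, y, p) -
        totalDeriv V (x, y, p) * totalDeriv₁ (totalDeriv T) (x, y, p, q)) /
        totalDeriv T (x, y, p) ^ 3 := by
  have h := hV.mul ((hasDerivAt_inv h0).comp_hasFDerivAt (x, y, p) hT)
  have h' : HasFDerivAt (transformedDeriv₁ fun z => (T z, V z)) _ (x, y, p) :=
    h.congr_of_eventuallyEq (Filter.Eventually.of_forall fun w => div_eq_mul_inv _ _)
  simp only [transformedDeriv₂, totalDeriv₁, h'.fderiv]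
  simp only [add_apply, smul_apply, smul_eq_mul, Function.comp_apply]
  field_simp
  ring

namespace FlatCoordinates

variable {a b c t v τ ρ σ κ θ l m : smoothAlgebra U}

/-- The computation gives d²v/dt² = (σ/τ²)(q - a p² - b p - c), and the factor σ/τ² has no zeros. -/
theorem equation_iff_transformedDeriv₂_eq_zero
    (h : FlatCoordinates (derX U) (derY U) a b c t v τ ρ σ κ θ l m)
    {F : 𝕜 × 𝕜 × 𝕜 × 𝕜 → 𝕜}
    (hF : ∀ (z : U) (p q : 𝕜), F (z.1.1, z.1.2, p, q) = q - (a z * p ^ 2 + b z * p + c z))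
    (z : U) {p q : 𝕜} (h0 : totalDeriv (rep t) (z.1.1, z.1.2, p) ≠ 0) :
    F (z.1.1, z.1.2, p, q) = 0 ↔
      transformedDeriv₂ (fun z => (rep t z, rep v z)) (z.1.1, z.1.2, p, q) = 0 := by
  have hT := totalDeriv₁_totalDeriv_rep t z p q
  have hV := totalDeriv₁_totalDeriv_rep v z p q
  have τ0 : τ z ≠ 0 := left_ne_zero_of_mul_eq_one (b := ρ z) (congrArg (fun f => f z) h.τρ)
  have σ0 : σ z ≠ 0 := left_ne_zero_of_mul_eq_one (b := κ z) (congrArg (fun f => f z) h.σκ)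
  rw [transformedDeriv₂_eq hV.1 hT.1 h0, hF, totalDeriv_rep, totalDeriv_rep, hT.2, hV.2]
  simp only [h.tx, h.ty, h.vx, h.vy, h.τx, h.τy, h.σx, h.σy, h.b_eq, h.θx, h.θy,
    Derivation.leibniz, map_zero]
  have key : ∀ S w : 𝕜, S = σ z / τ z ^ 2 * w → (w = 0 ↔ S = 0) := fun S w hS => by
    rw [hS]
    simp [τ0, σ0]
  refine key _ _ ?_
  simp
  field_simp
  ring

theorem linearizableAt (h : FlatCoordinates (derX U) (derY U) a b c t v τ ρ σ κ θ l m)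
    {F : 𝕜 × 𝕜 × 𝕜 × 𝕜 → 𝕜}
    (hF : ∀ (z : U) (p q : 𝕜), F (z.1.1, z.1.2, p, q) = q - (a z * p ^ 2 + b z * p + c z))
    (z : U) : LinearizableAt F z := by
  have app : ∀ {f g : smoothAlgebra U} (_ : f = g) (z : U), f z = g z := fun h _ => by rw [h]
  have τ0 : ∀ z, τ z ≠ 0 := fun z => left_ne_zero_of_mul_eq_one (app h.τρ z)
  have σ0 : ∀ z, σ z ≠ 0 := fun z => left_ne_zero_of_mul_eq_one (app h.σκ z)
  let Φ : 𝕜 × 𝕜 → 𝕜 × 𝕜 := fun z => (rep t z, rep v z)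
  have hΦ : ContDiffOn 𝕜 ∞ Φ U := (contDiffOn_rep t).prodMk (contDiffOn_rep v)
  -- The Jacobian matrix is triangular with diagonal τ, σ. Invertibility is shown at every point of
  -- U, because the inverse map has to be smooth on the whole target.
  have hd : ∀ z : U, ∃ e : (𝕜 × 𝕜) ≃L[𝕜] 𝕜 × 𝕜, HasFDerivAt Φ (e : 𝕜 × 𝕜 →L[𝕜] 𝕜 × 𝕜) z := by
    intro z
    have hz := (differentiableAt_of_contDiffOn (contDiffOn_rep t) z).hasFDerivAt.prodMk
      (differentiableAt_of_contDiffOn (contDiffOn_rep v) z).hasFDerivAt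
    let A := ContinuousLinearMap.fst 𝕜 𝕜 𝕜
    let B := ContinuousLinearMap.snd 𝕜 𝕜 𝕜
    refine ⟨ContinuousLinearEquiv.equivOfInverse
      ((τ z • A).prod ((θ z * σ z) • A + σ z • B))
      (((τ z)⁻¹ • A).prod ((σ z)⁻¹ • B - (θ z * (τ z)⁻¹) • A)) (fun w => ?_) (fun w => ?_), ?_⟩
    · have := τ0 z
      have := σ0 z
      ext <;> simp [A, B] <;> field_simp
      ring
    · have := τ0 z
      have := σ0 z
      ext <;> simp [A, B] <;> field_simp
      ring
    · refine hz.congr_fderiv ?_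
      have e1 : fderiv 𝕜 (rep t) z (1, 0) = τ z := app h.tx z
      have e2 : fderiv 𝕜 (rep t) z (0, 1) = 0 := app h.ty z
      have e3 : fderiv 𝕜 (rep v) z (1, 0) = θ z * σ z := app h.vx z
      have e4 : fderiv 𝕜 (rep v) z (0, 1) = σ z := app h.vy z
      ext <;> simp [e1, e2, e3, e4, A, B]
  obtain ⟨e, he⟩ := hd z
  have hz := hΦ.contDiffAt (U.isOpen.mem_nhds z.2)
  let Ψ := (hz.toOpenPartialHomeomorph Φ he (by simp)).restrOpen U U.isOpen
  have hs : Ψ.source ⊆ U := Set.inter_subset_right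
  refine ⟨Ψ, ⟨hz.mem_toOpenPartialHomeomorph_source he _, z.2⟩, hΦ.mono hs, ?_, ?_⟩
  · intro w hw
    have hw' := hs (Ψ.map_target hw)
    obtain ⟨e', he'⟩ := hd ⟨_, hw'⟩
    exact (Ψ.contDiffAt_symm hw he' (hΦ.contDiffAt (U.isOpen.mem_nhds hw'))).contDiffWithinAt
  · exact fun x y p q hxy h0 => h.equation_iff_transformedDeriv₂_eq_zero hF ⟨(x, y), hs hxy⟩ h0

end FlatCoordinates

end PointSymmetry

/-! ### Both claims of part (ii) near a regular point, and the theorem. -/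

namespace PainleveVI

open PointSymmetry TopologicalSpace smoothAlgebra

variable {𝕜 : Type*} [RCLike 𝕜]

/-- For the parameters `0, 0, 0, 1 / 2`, the sixth Painlevé equation has flat coordinates near
each regular point. -/
theorem exists_flatCoordinates {z : 𝕜 × 𝕜} (hz : z ∈ regularSet 𝕜) :
    ∃ (U : Opens (𝕜 × 𝕜)) (hU : (U : Set (𝕜 × 𝕜)) ⊆ regularSet 𝕜), z ∈ U ∧
      ∃ t v τ ρ σ κ θ l m : smoothAlgebra U, FlatCoordinates (derX U) (derY U) (smoothA hU)
        (smoothB hU) (smoothC hU 0 0 0 (1 / 2)) t v τ ρ σ κ θ l m := by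
  obtain ⟨K, K', r, hr, hK⟩ := exists_elliptic hz.1 hz.2.1
  obtain ⟨ε, hε, hεz⟩ := Metric.isOpen_iff.1 isOpen_regularSet z hz
  let U : Opens (𝕜 × 𝕜) := ⟨Metric.ball z (min ε r), Metric.isOpen_ball⟩
  have hU : (U : Set (𝕜 × 𝕜)) ⊆ regularSet 𝕜 :=
    (Metric.ball_subset_ball (min_le_left _ _)).trans hεz
  have hUr : ∀ w ∈ U, w.1 ∈ Metric.ball z.1 r := fun w hw =>
    ((le_max_left _ _).trans_lt (Metric.mem_ball.1 hw)).trans_le (min_le_right _ _)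
  let s : Set 𝕜 := Metric.ball z.1 r ∩ {x | x ≠ 0 ∧ x ≠ 1}
  have hs : IsOpen s := Metric.isOpen_ball.inter (isOpen_ne.inter isOpen_ne)
  have hUs : ∀ w ∈ U, w.1 ∈ s := fun w hw => ⟨hUr w hw, (hU hw).1, (hU hw).2.1⟩
  obtain ⟨c0, c1⟩ := contDiffOn_of_elliptic hs (fun x hx => hx.2.1) (fun x hx => hx.2.2)
    (fun x hx => (hK x hx.1).2.1) fun x hx => (hK x hx.1).2.2
  have d0 : ContDiffOn 𝕜 ∞ (fun w : 𝕜 × 𝕜 => K w.1) U := c0.comp contDiffOn_fst hUs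
  have d1 : ContDiffOn 𝕜 ∞ (fun w : 𝕜 × 𝕜 => K' w.1) U := c1.comp contDiffOn_fst hUs
  have d2 : ContDiffOn 𝕜 ∞ (fun w : 𝕜 × 𝕜 =>
      (fun x => (K x / 4 - (1 - 2 * x) * K' x) / (x * (1 - x))) w.1) U :=
    ((d0.div_const 4).sub ((by fun_prop : ContDiffOn 𝕜 ∞ (fun w : 𝕜 × 𝕜 => 1 - 2 * w.1) U).mul
      d1)).div (by fun_prop) fun w hw => mul_ne_zero (hU hw).1 (sub_ne_zero.2 (hU hw).2.1.symm)
  obtain ⟨e0, f0⟩ := derX_mk_comp_fst d0 d1 fun w hw => (hK _ (hUr w hw)).2.1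
  obtain ⟨e1, -⟩ := derX_mk_comp_fst (f := K')
    (f' := fun x => (K x / 4 - (1 - 2 * x) * K' x) / (x * (1 - x))) d1 d2 fun w hw => (hK _ (hUr w hw)).2.2
  refine ⟨U, hU, Metric.mem_ball_self (lt_min hε hr),
    exists_flatCoordinates_of_elliptic hU (convex_ball z _) (K := mk _ d0)
      (fun w => (hK _ (hUr w w.2)).1) e0 f0 ?_⟩
  rw [e1]
  ext w
  have h0 := (hU w.2).1
  have h1 := sub_ne_zero.2 (hU w.2).2.1
  have h2 := sub_ne_zero.2 (hU w.2).2.1.symm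
  simp
  field_simp
  ring

section Restriction

variable {U V : Opens (𝕜 × 𝕜)} (h : V ≤ U) (hU : (U : Set (𝕜 × 𝕜)) ⊆ regularSet 𝕜)
  (hV : (V : Set (𝕜 × 𝕜)) ⊆ regularSet 𝕜)

theorem restrict_smoothA : restrict h (smoothA hU) = smoothA hV :=
  ext fun z => by rw [restrict_apply, smoothA_apply, smoothA_apply]

theorem restrict_smoothB : restrict h (smoothB hU) = smoothB hV :=
  ext fun z => by rw [restrict_apply, smoothB_apply, smoothB_apply]

theorem restrict_smoothC (α β γ δ : 𝕜) :
    restrict h (smoothC hU α β γ δ) = smoothC hV α β γ δ :=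
  ext fun z => by rw [restrict_apply, smoothC_apply, smoothC_apply]

end Restriction

/-- For the parameters `0, 0, 0, 1 / 2`, the sixth Painlevé equation has an eight-dimensional
symmetry algebra near each regular point, and it is linearizable there. -/
theorem finrank_symmetryAlgebra_and_linearizableAt {z : 𝕜 × 𝕜} (hz : z ∈ regularSet 𝕜) :
    (∃ N : Set (𝕜 × 𝕜), IsOpen N ∧ z ∈ N ∧ N ⊆ regularSet 𝕜 ∧
      ∀ (V : Set (𝕜 × 𝕜)) (hV : IsOpen V), IsConnected V → V ⊆ N →
        Module.finrank 𝕜 (symmetryAlgebra (equation (0 : 𝕜) 0 0 (1 / 2)) V hV) = 8) ∧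
    LinearizableAt (equation (0 : 𝕜) 0 0 (1 / 2)) z := by
  obtain ⟨N, hN, hzN, t, v, τ, ρ, σ, κ, θ, l, m, h⟩ := exists_flatCoordinates hz
  refine ⟨⟨N, N.isOpen, hzN, hN, fun V hVo hVc hVN => ?_⟩, h.linearizableAt (fun w p q => ?_)
    ⟨z, hzN⟩⟩
  · let W : Opens (𝕜 × 𝕜) := ⟨V, hVo⟩
    have hWN : W ≤ N := hVN
    have hW : (W : Set (𝕜 × 𝕜)) ⊆ regularSet 𝕜 := hVN.trans hN
    have h' := h.map (restrict hWN) (D' := derX W) (E' := derY W) (der_restrict hWN _)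
      (der_restrict hWN _) fun f => der_comm _ _ f
    rw [restrict_smoothA hWN hN hW, restrict_smoothB hWN hN hW, restrict_smoothC hWN hN hW] at h'
    exact h'.finrank_symmetryAlgebra hVc fun X hX => satisfiesDetermining_equation_iff hW hX
  · rw [equation_eq_quadraticODE, smoothA_apply, smoothB_apply, smoothC_apply]
    rfl

end PainleveVI

theorem mainTheorem4 {𝕜 : Type*} [RCLike 𝕜] (α β γ δ : 𝕜) :
    (∀ (U : Set (𝕜 × 𝕜)) (hU : IsOpen U), U ⊆ PainleveVI.regularSet 𝕜 →
      PointSymmetry.symmetryAlgebra (PainleveVI.equation α β γ δ) U hU ≠ ⊥ →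
        α = 0 ∧ β = 0 ∧ γ = 0 ∧ δ = 1 / 2) ∧
    (α = 0 ∧ β = 0 ∧ γ = 0 ∧ δ = 1 / 2 →
      ∀ z ∈ PainleveVI.regularSet 𝕜,
        (∃ N : Set (𝕜 × 𝕜), IsOpen N ∧ z ∈ N ∧ N ⊆ PainleveVI.regularSet 𝕜 ∧
          ∀ (V : Set (𝕜 × 𝕜)) (hV : IsOpen V), IsConnected V → V ⊆ N →
            Module.finrank 𝕜
              (PointSymmetry.symmetryAlgebra (PainleveVI.equation α β γ δ) V hV) = 8) ∧
        PointSymmetry.LinearizableAt (PainleveVI.equation α β γ δ) z) := by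
  refine ⟨fun U hUo hU h => PainleveVI.params_of_symmetryAlgebra_ne_bot hUo hU h, ?_⟩
  rintro ⟨rfl, rfl, rfl, rfl⟩ z hz
  exact PainleveVI.finrank_symmetryAlgebra_and_linearizableAt hz
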